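/- Let $d\ge1$, $s\in[1/2,1)$, $\lambda,\Lambda,R_0>0$. There is a constant $c>0$ depending only on $d,s,\lambda,\Lambda,R_0$ such that the following holds for all $\rho\ge0$, $R\in(\rho,R_0]$, $a\ge0$. Notation. $B_r=B_r(0)\subset\mathbb R^d$ is the open ball, $I_r=(-r^{2s},0]$, $Q_r=B_r\times I_r$. $\mathcal K_\rho$ is the class of measurable $K:\mathbb R^d\to[0,\infty)$ with $K(y)\ge\lambda\min\{|y|^{-d-2s},\rho^{-d-2s}\}$ for all $y\ne0$ (with $\rho^{-d-2s}:=\infty$ if $\rho=0$), $\int_{B_{2r}\setminus B_r}K(y)\,dy\le\Lambda r^{-2s}$ for all $r>0$, and, if $s=1/2$, also $\int_{B_{2r}\setminus B_r}yK(y)\,dy=0$ for all $r>0$. Put $\delta_yw(x)=w(x+y)-w(x)-y\cdot\nabla w(x)$ if $s>1/2$, $\delta_yw(x)=w(x+y)-w(x)-y\cdot\nabla w(x)\mathbf 1_{B_1}(y)$ if $s=1/2$, and $$\mathcal M^-_\rho w(x)=\inf_{K\in\mathcal K_\rho}\int_{\mathbb R^d}\delta_yw(x)K(y)\,dy$$ (with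 $\inf\emptyset=+\infty$). Let $u:\mathbb R^d\times I_R\to[0,\infty)$ be bounded and measurable, with measurable time slices, lower semicontinuous in $Q_R$, and a viscosity supersolution of $$\partial_tu+\Lambda|\nabla u|-\mathcal M^-_\rho u\ge -R^{-2s}a\quad\text{in }Q_R ,$$ that is: whenever $(x_0,t_0)\in Q_R$, $\varepsilon>0$, $C_\varepsilon:=B_\varepsilon(x_0)\times(t_0-\varepsilon,t_0]\subseteq Q_R$, and $\varphi:C_\varepsilon\to\mathbb R$ is left-differentiable in time and $C^{1,1}$ in space with $\varphi\le u$ in $C_\varepsilon$ and $\varphi(x_0,t_0)=u(x_0,t_0)$, the function $v$ equal to $\varphi$ in $C_\varepsilon$ and to $u$ elsewhere satisfies $\partial_tv(x_0,t_0)+\Lambda|\nabla v(x_0,t_0)|-\mathcal M^-_\rho v(\cdot,t_0)(x_0)\ge -R^{-2s}a$, where $\partial_t$ is the left derivative. Then $$\inf_{Q_{R/2}}u\ \ge\ c\int_{I_R\setminus I_{R/2}}\int_{\mathbb R^d}\frac{u(x,t)}{(R+|x|)^{d+2s}}\,dx\,dt-a .$$ -/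

import Mathlib

noncomputable section

namespace NonlocalHarnack

/-- Euclidean space `ℝᵈ`. -/
abbrev Space (d : ℕ) : Type := EuclideanSpace ℝ (Fin d)

/-- The time interval `I_R = (-R^{2s}, 0]`. -/
def timeInterval (s R : ℝ) : Set ℝ := Set.Ioc (-(R ^ (2 * s))) 0

/-- The parabolic cylinder `Q_R = B_R × I_R`. -/
def cylinder (d : ℕ) (s R : ℝ) : Set (Space d × ℝ) :=
  Metric.ball (0 : Space d) R ×ˢ timeInterval s R

/-- `min {|y|^{-d-2s}, ρ^{-d-2s}}`, with the convention `ρ^{-d-2s} = ∞` for `ρ = 0`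
(only used for `y ≠ 0`). -/
def truncatedKernel (d : ℕ) (s ρ : ℝ) (y : Space d) : ℝ :=
  if ρ = 0 then ‖y‖ ^ (-(d : ℝ) - 2 * s)
  else min (‖y‖ ^ (-(d : ℝ) - 2 * s)) (ρ ^ (-(d : ℝ) - 2 * s))

/-- The half-open annulus `B_{2r} ∖ B_r`. -/
def annulus (d : ℕ) (r : ℝ) : Set (Space d) :=
  Metric.ball (0 : Space d) (2 * r) \ Metric.ball (0 : Space d) r

/-- The class `𝒦_ρ` of admissible kernels. -/
structure IsAdmissibleKernel (d : ℕ) (s lam Lam ρ : ℝ) (K : Space d → ℝ) : Prop where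
  measurable : Measurable K
  nonneg : ∀ y, 0 ≤ K y
  lower_bound : ∀ y, y ≠ 0 → lam * truncatedKernel d s ρ y ≤ K y
  upper_bound : ∀ r : ℝ, 0 < r →
    ∫⁻ y in annulus d r, ENNReal.ofReal (K y) ≤ ENNReal.ofReal (Lam * r ^ (-(2 * s)))
  cancellation : s = 1 / 2 → ∀ r : ℝ, 0 < r → ∫ y in annulus d r, K y • y = 0

open Classical in
/-- The difference operator `δ_y w(x)`. -/
def diffOp {d : ℕ} (s : ℝ) (w : Space d → ℝ) (x y : Space d) : ℝ :=
  if s < 1 / 2 then w (x + y) - w x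
  else if s = 1 / 2 then
    w (x + y) - w x - (if y ∈ Metric.ball (0 : Space d) 1 then inner ℝ y (gradient w x) else 0)
  else w (x + y) - w x - inner ℝ y (gradient w x)

/-- The linear operator `L_K w(x) = ∫ δ_y w(x) K(y) dy`. -/
def linearOp {d : ℕ} (s : ℝ) (K : Space d → ℝ) (w : Space d → ℝ) (x : Space d) : ℝ :=
  ∫ y, diffOp s w x y * K y

/-- The Pucci extremal operator `ℳ_ρ⁻ w(x) = inf_{K ∈ 𝒦_ρ} L_K w(x)`. The infimum is taken in the
extended reals, so that the infimum over the empty class is `+∞`. -/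
def pucciMin {d : ℕ} (s lam Lam ρ : ℝ) (w : Space d → ℝ) (x : Space d) : EReal :=
  ⨅ K : {K : Space d → ℝ // IsAdmissibleKernel d s lam Lam ρ K}, ((linearOp s K.1 w x : ℝ) : EReal)

/-- The operator `F(w) = ℳ_ρ⁻ w - Λ |∇w|`; thus `∂ₜu - F(u) = ∂ₜu + Λ |∇u| - ℳ_ρ⁻ u`. -/
def driftPucciMin {d : ℕ} (s lam Lam ρ : ℝ) (w : Space d → ℝ) (x : Space d) : EReal :=
  pucciMin s lam Lam ρ w x - ((Lam * ‖gradient w x‖ : ℝ) : EReal)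

/-- `u` is a bounded (Lebesgue) measurable function on `ℝᵈ × I`, all of whose time slices are
(Lebesgue) measurable. -/
structure IsBoundedMeasurable {d : ℕ} (I : Set ℝ) (u : Space d → ℝ → ℝ) : Prop where
  aemeasurable : AEMeasurable (fun p : Space d × ℝ => u p.1 p.2)
    ((MeasureTheory.volume : MeasureTheory.Measure (Space d × ℝ)).restrict (Set.univ ×ˢ I))
  aemeasurable_slice : ∀ t ∈ I, AEMeasurable (fun x => u x t) MeasureTheory.volume
  bounded : ∃ M : ℝ, ∀ x, ∀ t ∈ I, |u x t| ≤ M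

/-- `φ` is left-differentiable in time and `C^{1,1}` in space on `B_ε(x₀) × (t₀ - ε, t₀]`. -/
structure IsTestFunction {d : ℕ} (x₀ : Space d) (t₀ ε : ℝ) (φ : Space d → ℝ → ℝ) : Prop where
  left_differentiable : ∀ x ∈ Metric.ball x₀ ε, ∀ t ∈ Set.Ioc (t₀ - ε) t₀,
    DifferentiableWithinAt ℝ (fun τ => φ x τ) (Set.Iic t) t
  differentiable : ∀ t ∈ Set.Ioc (t₀ - ε) t₀, ∀ x ∈ Metric.ball x₀ ε,
    DifferentiableAt ℝ (fun z => φ z t) x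
  gradient_lipschitz : ∀ t ∈ Set.Ioc (t₀ - ε) t₀, ∃ C : NNReal,
    LipschitzOnWith C (fun x => gradient (fun z => φ z t) x) (Metric.ball x₀ ε)

open Classical in
/-- The function equal to `φ` in `B_ε(x₀) × (t₀ - ε, t₀]` and to `u` elsewhere. -/
def patch {d : ℕ} (x₀ : Space d) (t₀ ε : ℝ) (φ u : Space d → ℝ → ℝ) : Space d → ℝ → ℝ :=
  fun x t => if x ∈ Metric.ball x₀ ε ∧ t ∈ Set.Ioc (t₀ - ε) t₀ then φ x t else u x t

/-- `u` solves `∂ₜu - F(u) ≥ f` in `Ω × I` in the viscosity sense, where `∂ₜ` is the left derivative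
in time and `F` acts on functions of the space variable. -/
structure IsViscositySupersolution {d : ℕ} (F : (Space d → ℝ) → Space d → EReal)
    (Ω : Set (Space d)) (I : Set ℝ) (f : Space d → ℝ → ℝ) (u : Space d → ℝ → ℝ) : Prop where
  bounded_measurable : IsBoundedMeasurable I u
  lowerSemicontinuous : LowerSemicontinuousOn (fun p : Space d × ℝ => u p.1 p.2) (Ω ×ˢ I)
  supersolution : ∀ x₀ ∈ Ω, ∀ t₀ ∈ I, ∀ ε : ℝ, 0 < ε →
    Metric.ball x₀ ε ×ˢ Set.Ioc (t₀ - ε) t₀ ⊆ Ω ×ˢ I →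
    ∀ φ : Space d → ℝ → ℝ, IsTestFunction x₀ t₀ ε φ →
      φ x₀ t₀ = u x₀ t₀ →
      (∀ x ∈ Metric.ball x₀ ε, ∀ t ∈ Set.Ioc (t₀ - ε) t₀, φ x t ≤ u x t) →
      ((f x₀ t₀ : ℝ) : EReal) ≤
        ((derivWithin (fun τ => patch x₀ t₀ ε φ u x₀ τ) (Set.Iic t₀) t₀ : ℝ) : EReal)
          - F (fun x => patch x₀ t₀ ε φ u x t₀) x₀

end NonlocalHarnack

end

open MeasureTheory Set Filter Topology

noncomputable section

namespace NonlocalHarnack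

/-! The nonlocal term feeds the whole mass of `u` into every point of `B_R`. For `|x₀| < R` and `ρ <
R`, each admissible kernel satisfies `K(y) ≥ lam (R + |x₀ + y|)^{-d-2s}`. If a concave paraboloid
touches `u` from below at `(x₀, t₀)`, then `L_K u(x₀) ≥ lam f(t₀) - C P R^{-2s}`, where `f(t)` is
the weighted integral of `u(·, t)` and `P` controls the size of the paraboloid
(`exists_linearOp_lower_bound`, `exists_contact_inequality`).

This suggests comparing `u` with a barrier whose time derivative is a fraction of `f`. With `T =
R^{2s}` and `p = 1 - |x|²/(3R/4)²`, it is `(lam/2) exp(-κ(t+T)/T) (∫_{-T}^t g) p₊²`, minus `(R^{-2s}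
a + η)(t+T) + η`, where `g ≤ f` is upper semicontinuous. Suppose `u` minus the barrier has a
negative minimum at `(x₀, t₀)`; write `M` for the time factor and `p₀ = p(x₀) > 0`. The square `p₊²`
lies above its tangent in `p` at `p₀`, which is a paraboloid in `x` with gradient and Hessian of
order `M p₀`, so drift and diffusion cost at most `C M p₀/T`. Half of `lam f` pays for the growth of
`∫ g`. The decay in time gains `κ M p₀²/T`, which is not enough when `p₀` is small; but there `u` is
at least `M/4 - M p₀²` on `B_{R/2}`, so the other half of `lam f` is bounded below by a multiple of
`M/T`. For `κ` large, the sum contradicts the viscosity inequality (`barrier_contradiction`,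
`exists_barrier_le`). Letting `g` approach `f` in `L¹` on the early time interval and `η` tend to
zero yields the estimate. -/

/-! ### Moments of admissible kernels -/

theorem integrableOn_of_lintegral_le {α : Type*} [MeasurableSpace α] {μ : Measure α} {S : Set α}
    {f : α → ℝ} (hf : Measurable f) (hf0 : ∀ x, 0 ≤ f x) {c : ℝ} (hc : 0 ≤ c)
    (h : ∫⁻ x in S, ENNReal.ofReal (f x) ∂μ ≤ ENNReal.ofReal c) :
    IntegrableOn f S μ ∧ ∫ x in S, f x ∂μ ≤ c := by
  refine ⟨⟨hf.aestronglyMeasurable, ?_⟩, ?_⟩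
  · rw [hasFiniteIntegral_iff_ofReal (Eventually.of_forall hf0)]
    exact h.trans_lt ENNReal.ofReal_lt_top
  · rw [integral_eq_lintegral_of_nonneg_ae (Eventually.of_forall hf0) hf.aestronglyMeasurable]
    exact ENNReal.toReal_le_of_le_ofReal hc h

/-- The upper bound on `K` is available only on dyadic annuli, so every moment is obtained by
covering with annuli and summing a geometric series. -/
theorem IsAdmissibleKernel.lintegral_mul_le_tsum {d : ℕ} {s lam Lam ρ : ℝ} {K : Space d → ℝ}
    (hK : IsAdmissibleKernel d s lam Lam ρ K) {S : Set (Space d)} {rad wt : ℕ → ℝ}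
    {w : Space d → ℝ} (hrad : ∀ n, 0 < rad n) (hwt : ∀ n, 0 ≤ wt n)
    (hS : S ⊆ ⋃ n, annulus d (rad n)) (hw : ∀ n, ∀ y ∈ annulus d (rad n), w y ≤ wt n) :
    ∫⁻ y in S, ENNReal.ofReal (w y * K y) ≤
      ∑' n, ENNReal.ofReal (wt n * (Lam * rad n ^ (-(2 * s)))) := by
  calc ∫⁻ y in S, ENNReal.ofReal (w y * K y)
      ≤ ∫⁻ y in ⋃ n, annulus d (rad n), ENNReal.ofReal (w y * K y) := lintegral_mono_set hS
    _ ≤ ∑' n, ∫⁻ y in annulus d (rad n), ENNReal.ofReal (w y * K y) := lintegral_iUnion_le _ _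
    _ ≤ _ := by
      refine ENNReal.tsum_le_tsum fun n => ?_
      have hm : MeasurableSet (annulus d (rad n)) :=
        Metric.isOpen_ball.measurableSet.diff Metric.isOpen_ball.measurableSet
      calc ∫⁻ y in annulus d (rad n), ENNReal.ofReal (w y * K y)
          ≤ ∫⁻ y in annulus d (rad n), ENNReal.ofReal (wt n) * ENNReal.ofReal (K y) := by
            refine setLIntegral_mono' hm fun y hy => ?_
            rw [← ENNReal.ofReal_mul (hwt n)]
            exact ENNReal.ofReal_le_ofReal (mul_le_mul_of_nonneg_right (hw n y hy) (hK.nonneg y))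
        _ = ENNReal.ofReal (wt n) * ∫⁻ y in annulus d (rad n), ENNReal.ofReal (K y) :=
            lintegral_const_mul _ hK.measurable.ennreal_ofReal
        _ ≤ ENNReal.ofReal (wt n) * ENNReal.ofReal (Lam * rad n ^ (-(2 * s))) := by
            gcongr; exact hK.upper_bound _ (hrad n)
        _ = _ := (ENNReal.ofReal_mul (hwt n)).symm

theorem tsum_ofReal_geometric {A q : ℝ} (hA : 0 ≤ A) (hq : 0 ≤ q) (hq1 : q < 1) :
    ∑' n : ℕ, ENNReal.ofReal (A * q ^ n) = ENNReal.ofReal (A * (1 - q)⁻¹) := by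
  rw [← ENNReal.ofReal_tsum_of_nonneg (fun n => by positivity)
    ((summable_geometric_of_lt_one hq hq1).mul_left A), tsum_mul_left,
    tsum_geometric_of_lt_one hq hq1]

theorem exists_two_pow_mul_le {r t : ℝ} (hr : 0 < r) (h : r ≤ t) :
    ∃ n : ℕ, 2 ^ n * r ≤ t ∧ t < 2 * (2 ^ n * r) := by
  obtain ⟨n, h1, h2⟩ := exists_nat_pow_near (x := t / r) (y := 2)
    ((one_le_div hr).2 h) one_lt_two
  refine ⟨n, (le_div_iff₀ hr).1 h1, ?_⟩
  have := (div_lt_iff₀ hr).1 h2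
  rw [pow_succ] at this
  linarith

theorem mem_annulus {d : ℕ} {r : ℝ} {y : Space d} : y ∈ annulus d r ↔ r ≤ ‖y‖ ∧ ‖y‖ < 2 * r := by
  simp [annulus, and_comm]

/-- Moments of an admissible kernel away from the origin. -/
theorem exists_integral_compl_ball_le (d : ℕ) {s lam Lam β : ℝ} (hLam : 0 < Lam) (hβ0 : 0 ≤ β)
    (hβ : β < 2 * s) :
    ∃ C : ℝ, 0 ≤ C ∧ ∀ (ρ : ℝ) (K : Space d → ℝ), IsAdmissibleKernel d s lam Lam ρ K →
      ∀ r : ℝ, 0 < r → IntegrableOn (fun y => ‖y‖ ^ β * K y) (Metric.ball 0 r)ᶜ ∧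
        ∫ y in (Metric.ball 0 r)ᶜ, ‖y‖ ^ β * K y ≤ C * r ^ (β - 2 * s) := by
  have hq1 : (2 : ℝ) ^ (β - 2 * s) < 1 := Real.rpow_lt_one_of_one_lt_of_neg one_lt_two (by linarith)
  have hq0 : (0 : ℝ) ≤ 2 ^ (β - 2 * s) := by positivity
  have hq2 : 0 ≤ (1 - (2 : ℝ) ^ (β - 2 * s))⁻¹ := inv_nonneg.2 (by linarith)
  refine ⟨Lam * 2 ^ β * (1 - 2 ^ (β - 2 * s))⁻¹, by positivity, fun ρ K hK r hr => ?_⟩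
  refine integrableOn_of_lintegral_le
    ((measurable_norm.pow_const β).mul hK.measurable)
    (fun y => mul_nonneg (by positivity) (hK.nonneg y)) (by positivity) ?_
  refine (hK.lintegral_mul_le_tsum (rad := fun n => 2 ^ n * r) (wt := fun n => (2 * (2 ^ n * r)) ^ β)
    (fun n => by positivity) (fun n => by positivity) (fun y hy => ?_) (fun n y hy => ?_)).trans ?_
  · have : r ≤ ‖y‖ := by simpa using hy
    obtain ⟨n, h⟩ := exists_two_pow_mul_le hr this
    exact mem_iUnion.2 ⟨n, mem_annulus.2 h⟩
  · exact Real.rpow_le_rpow (norm_nonneg _) (mem_annulus.1 hy).2.le hβ0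
  · have key : ∀ n : ℕ, (2 * (2 ^ n * r)) ^ β * (Lam * (2 ^ n * r) ^ (-(2 * s))) =
        (Lam * 2 ^ β * r ^ (β - 2 * s)) * (2 ^ (β - 2 * s)) ^ n := by
      intro n
      have hx : (0 : ℝ) < 2 ^ n * r := by positivity
      rw [Real.mul_rpow two_pos.le hx.le]
      have : (2 ^ n * r) ^ β * (2 ^ n * r) ^ (-(2 * s)) = (2 ^ (β - 2 * s)) ^ n * r ^ (β - 2 * s) := by
        rw [← Real.rpow_add hx, ← sub_eq_add_neg, Real.mul_rpow (by positivity) hr.le,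
          ← Real.rpow_natCast, ← Real.rpow_natCast, ← Real.rpow_mul two_pos.le,
          ← Real.rpow_mul two_pos.le, mul_comm (n : ℝ)]
      linear_combination (2 ^ β * Lam) * this
    simp_rw [key]
    rw [tsum_ofReal_geometric (by positivity) hq0 hq1]
    exact ENNReal.ofReal_le_ofReal (le_of_eq (by ring))

/-- The second moment of an admissible kernel near the origin. -/
theorem exists_integral_ball_sq_le (d : ℕ) {s lam Lam : ℝ} (hLam : 0 < Lam) (hs1 : s < 1) :
    ∃ C : ℝ, 0 ≤ C ∧ ∀ (ρ : ℝ) (K : Space d → ℝ), IsAdmissibleKernel d s lam Lam ρ K →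
      ∀ r : ℝ, 0 < r → IntegrableOn (fun y => ‖y‖ ^ 2 * K y) (Metric.ball 0 r) ∧
        ∫ y in Metric.ball 0 r, ‖y‖ ^ 2 * K y ≤ C * r ^ (2 - 2 * s) := by
  have hq1 : (2⁻¹ : ℝ) ^ (2 - 2 * s) < 1 :=
    Real.rpow_lt_one (by norm_num) (by norm_num) (by linarith)
  have hq0 : (0 : ℝ) ≤ 2⁻¹ ^ (2 - 2 * s) := by positivity
  have hq2 : 0 ≤ (1 - (2⁻¹ : ℝ) ^ (2 - 2 * s))⁻¹ := inv_nonneg.2 (by linarith)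
  refine ⟨Lam * 4 * (1 - 2⁻¹ ^ (2 - 2 * s))⁻¹, by positivity, fun ρ K hK r hr => ?_⟩
  refine integrableOn_of_lintegral_le
    ((measurable_norm.pow_const 2).mul hK.measurable)
    (fun y => mul_nonneg (by positivity) (hK.nonneg y)) (by positivity) ?_
  -- The annuli do not cover the origin, but the integrand vanishes there. This avoids using that
  -- points are null, which fails for `d = 0`.
  have hz : ∫⁻ y in Metric.ball (0 : Space d) r, ENNReal.ofReal (‖y‖ ^ 2 * K y) ≤
      ∫⁻ y in Metric.ball (0 : Space d) r \ {0}, ENNReal.ofReal (‖y‖ ^ 2 * K y) := by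
    rw [← lintegral_indicator Metric.isOpen_ball.measurableSet,
      ← lintegral_indicator (Metric.isOpen_ball.measurableSet.diff (measurableSet_singleton 0))]
    refine lintegral_mono fun y => ?_
    by_cases hy : y = 0
    · subst hy
      by_cases h : (0 : Space d) ∈ Metric.ball (0 : Space d) r <;> simp [indicator]
    · simp [indicator, hy]
  refine hz.trans ((hK.lintegral_mul_le_tsum (rad := fun n => 2⁻¹ ^ n * r)
    (wt := fun n => (2 * (2⁻¹ ^ n * r)) ^ 2)
    (fun n => by positivity) (fun n => by positivity) (fun y hy => ?_) (fun n y hy => ?_)).trans ?_)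
  · have h1 : ‖y‖ < r := by simpa using hy.1
    have h0 : 0 < ‖y‖ := norm_pos_iff.2 (by simpa using hy.2)
    obtain ⟨n, h2, h3⟩ := exists_nat_pow_near_of_lt_one (x := ‖y‖ / r) (y := (2⁻¹ : ℝ))
      (by positivity) ((div_le_one hr).2 h1.le) (by norm_num) (by norm_num)
    rw [lt_div_iff₀ hr] at h2
    rw [div_le_iff₀ hr] at h3
    -- The powers localise `‖y‖` in an interval closed on the right, whereas annuli are closed on
    -- the left; the endpoint belongs to the next larger annulus.
    have hp : (2⁻¹ : ℝ) ^ (n + 1) * r = 2⁻¹ * (2⁻¹ ^ n * r) := by ring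
    rcases h3.lt_or_eq with h | h
    · exact mem_iUnion.2 ⟨n + 1, mem_annulus.2 ⟨h2.le, by rw [hp]; linarith⟩⟩
    · exact mem_iUnion.2 ⟨n, mem_annulus.2 ⟨h.ge, by linarith⟩⟩
  · have := (mem_annulus.1 hy).2.le
    gcongr
  · have key : ∀ n : ℕ, (2 * (2⁻¹ ^ n * r)) ^ 2 * (Lam * (2⁻¹ ^ n * r) ^ (-(2 * s))) =
        (Lam * 4 * r ^ (2 - 2 * s)) * (2⁻¹ ^ (2 - 2 * s)) ^ n := by
      intro n
      have hx : (0 : ℝ) < 2⁻¹ ^ n * r := by positivity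
      have : (2⁻¹ ^ n * r) ^ 2 * (2⁻¹ ^ n * r) ^ (-(2 * s)) =
          (2⁻¹ ^ (2 - 2 * s)) ^ n * r ^ (2 - 2 * s) := by
        rw [← Real.rpow_natCast (2⁻¹ ^ n * r) 2, ← Real.rpow_add hx, Nat.cast_ofNat,
          ← sub_eq_add_neg, Real.mul_rpow (by positivity) hr.le,
          ← Real.rpow_natCast, ← Real.rpow_natCast, ← Real.rpow_mul (by norm_num),
          ← Real.rpow_mul (by norm_num), mul_comm (n : ℝ)]
      linear_combination (4 * Lam) * this
    simp_rw [key]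
    rw [tsum_ofReal_geometric (by positivity) hq0 hq1]
    exact ENNReal.ofReal_le_ofReal (le_of_eq (by ring))

theorem IsAdmissibleKernel.integrableOn_annulus {d : ℕ} {s lam Lam ρ : ℝ} {K : Space d → ℝ}
    (hK : IsAdmissibleKernel d s lam Lam ρ K) (hLam : 0 < Lam) {r : ℝ} (hr : 0 < r) :
    IntegrableOn (fun y => K y • y) (annulus d r) := by
  have hm : MeasurableSet (annulus d r) :=
    Metric.isOpen_ball.measurableSet.diff Metric.isOpen_ball.measurableSet
  have h1 : IntegrableOn K (annulus d r) :=
    (integrableOn_of_lintegral_le hK.measurable hK.nonneg (by positivity)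
      (hK.upper_bound r hr)).1
  refine (h1.const_mul (2 * r)).mono'
    (hK.measurable.aestronglyMeasurable.smul measurable_id.aestronglyMeasurable) ?_
  refine (ae_restrict_iff' hm).2 (Eventually.of_forall fun y hy => ?_)
  rw [norm_smul, Real.norm_of_nonneg (hK.nonneg y), mul_comm]
  exact mul_le_mul_of_nonneg_right (mem_annulus.1 hy).2.le (hK.nonneg y)

/-- For `s = 1/2` the first moment vanishes on every dyadic shell. -/
theorem IsAdmissibleKernel.integral_dyadic_shell {d : ℕ} {s lam Lam ρ : ℝ} {K : Space d → ℝ}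
    (hK : IsAdmissibleKernel d s lam Lam ρ K) (hLam : 0 < Lam) (hs : s = 1 / 2) {r : ℝ}
    (hr : 0 < r) (n : ℕ) :
    IntegrableOn (fun y => K y • y) (Metric.ball (0 : Space d) (2 ^ n * r) \ Metric.ball 0 r) ∧
      ∫ y in Metric.ball (0 : Space d) (2 ^ n * r) \ Metric.ball 0 r, K y • y = 0 := by
  induction n with
  | zero => simp
  | succ n ih =>
    have hn : (1 : ℝ) ≤ 2 ^ n := one_le_pow₀ one_le_two
    have hU : Metric.ball (0 : Space d) (2 ^ (n + 1) * r) \ Metric.ball 0 r =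
        (Metric.ball (0 : Space d) (2 ^ n * r) \ Metric.ball 0 r) ∪ annulus d (2 ^ n * r) := by
      ext y
      simp only [Set.mem_sdiff, mem_union, mem_annulus, Metric.mem_ball, dist_zero_right, not_lt]
      rw [show (2 : ℝ) ^ (n + 1) * r = 2 * (2 ^ n * r) by ring]
      have : r ≤ 2 ^ n * r := le_mul_of_one_le_left hr.le hn
      constructor
      · rintro ⟨h1, h2⟩
        rcases lt_or_ge ‖y‖ (2 ^ n * r) with h | h
        · exact Or.inl ⟨h, h2⟩
        · exact Or.inr ⟨h, h1⟩
      · rintro (⟨h1, h2⟩ | ⟨h1, h2⟩)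
        · exact ⟨by linarith, h2⟩
        · exact ⟨h2, by linarith⟩
    have hr' : 0 < 2 ^ n * r := by positivity
    have hi := hK.integrableOn_annulus hLam hr'
    have hd : Disjoint (Metric.ball (0 : Space d) (2 ^ n * r) \ Metric.ball 0 r)
        (annulus d (2 ^ n * r)) :=
      Set.disjoint_left.2 fun y hy hy' => hy'.2 hy.1
    rw [hU]
    refine ⟨ih.1.union hi, ?_⟩
    rw [setIntegral_union hd (Metric.isOpen_ball.measurableSet.diff
      Metric.isOpen_ball.measurableSet) ih.1 hi, ih.2, hK.cancellation hs _ hr', zero_add]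

/-! ### The tail weight -/

/-- The weight `(R + |x|)^{-d-2s}`. -/
def tailWeight (d : ℕ) (s R : ℝ) (x : Space d) : ℝ := (R + ‖x‖) ^ (-((d : ℝ) + 2 * s))

theorem tailWeight_pos {d : ℕ} {s R : ℝ} (hR : 0 < R) (x : Space d) : 0 < tailWeight d s R x := by
  unfold tailWeight; positivity

theorem div_eq_mul_tailWeight {d : ℕ} {s R : ℝ} (hR : 0 < R) (x : Space d) (a : ℝ) :
    a / (R + ‖x‖) ^ ((d : ℝ) + 2 * s) = a * tailWeight d s R x := by
  rw [tailWeight, Real.rpow_neg (by positivity), div_eq_mul_inv]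

theorem continuous_tailWeight {d : ℕ} {s R : ℝ} (hR : 0 < R) :
    Continuous (tailWeight d s R) := by
  unfold tailWeight
  refine (continuous_const.add continuous_norm).rpow_const fun x => Or.inl (ne_of_gt ?_)
  exact add_pos_of_pos_of_nonneg hR (norm_nonneg x)

/-- Substituting `x = R x'` reduces to `R = 1`; the weight scales by `R^{-d-2s}` and the volume by
`R^d`. -/
theorem exists_integral_tailWeight_eq (d : ℕ) {s : ℝ} (hs : 0 < s) :
    ∃ C : ℝ, 0 ≤ C ∧ ∀ R : ℝ, 0 < R → Integrable (tailWeight d s R) ∧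
      ∫ x, tailWeight d s R x = C * R ^ (-(2 * s)) := by
  have hint : Integrable (fun x : Space d => (1 + ‖x‖) ^ (-((d : ℝ) + 2 * s))) :=
    integrable_one_add_norm (by simp; linarith)
  refine ⟨∫ x : Space d, (1 + ‖x‖) ^ (-((d : ℝ) + 2 * s)),
    integral_nonneg fun x => by positivity, fun R hR => ?_⟩
  have heq : tailWeight d s R = fun x : Space d =>
      R ^ (-((d : ℝ) + 2 * s)) * (1 + ‖R⁻¹ • x‖) ^ (-((d : ℝ) + 2 * s)) := by
    funext x
    rw [tailWeight, ← Real.mul_rpow hR.le (by positivity), norm_smul, norm_inv,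
      Real.norm_of_nonneg hR.le, mul_add, mul_one, mul_inv_cancel_left₀ hR.ne']
  rw [heq]
  refine ⟨(hint.comp_smul (inv_ne_zero hR.ne')).const_mul _, ?_⟩
  rw [integral_const_mul, Measure.integral_comp_smul volume
    (fun x : Space d => (1 + ‖x‖) ^ (-((d : ℝ) + 2 * s))) R⁻¹]
  simp only [finrank_euclideanSpace, Fintype.card_fin, inv_pow, inv_inv, smul_eq_mul]
  rw [abs_of_pos (by positivity), ← Real.rpow_natCast, ← mul_assoc, ← Real.rpow_add hR]
  rw [mul_comm]
  congr 2
  ring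

/-- Both terms of the minimum are handled by monotonicity: `‖y‖ ≤ ‖x₀ + y‖ + ‖x₀‖ ≤ R + ‖x₀ + y‖`,
and `ρ < R ≤ R + ‖x₀ + y‖`. This is the only use of the lower bound on kernels. -/
theorem IsAdmissibleKernel.tailWeight_le {d : ℕ} {s lam Lam ρ : ℝ} {K : Space d → ℝ}
    (hK : IsAdmissibleKernel d s lam Lam ρ K) (hs : 0 < s) (hlam : 0 < lam) (hρ : 0 ≤ ρ) {R : ℝ}
    (hR : ρ < R) {x₀ y : Space d} (hx₀ : ‖x₀‖ < R) (hy : y ≠ 0) :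
    lam * tailWeight d s R (x₀ + y) ≤ K y := by
  refine le_trans (mul_le_mul_of_nonneg_left ?_ hlam.le) (hK.lower_bound y hy)
  have hexp : -((d : ℝ) + 2 * s) = -(d : ℝ) - 2 * s := by ring
  have hneg : -(d : ℝ) - 2 * s ≤ 0 := by have : (0 : ℝ) ≤ d := d.cast_nonneg; linarith
  have hn : ‖y‖ ≤ R + ‖x₀ + y‖ := by
    have : ‖y‖ ≤ ‖x₀ + y‖ + ‖x₀‖ := by simpa using norm_sub_le (x₀ + y) x₀
    linarith
  have h1 : tailWeight d s R (x₀ + y) ≤ ‖y‖ ^ (-(d : ℝ) - 2 * s) := by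
    rw [tailWeight, hexp]
    exact Real.rpow_le_rpow_of_nonpos (norm_pos_iff.2 hy) hn hneg
  unfold truncatedKernel
  split_ifs with h
  · exact h1
  · refine le_min h1 ?_
    rw [tailWeight, hexp]
    exact Real.rpow_le_rpow_of_nonpos (lt_of_le_of_ne hρ (Ne.symm h))
      (by linarith [norm_nonneg (x₀ + y)]) hneg

/-! ### Linear operators at a touching paraboloid -/

/-- Integrability of a kernel against a compensated difference that is quadratic near the origin,
and the resulting lower bound when the difference lies above a concave paraboloid. -/
theorem IsAdmissibleKernel.lower_bound_of_paraboloid {d : ℕ} {s lam Lam ρ R : ℝ}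
    {K : Space d → ℝ} (hK : IsAdmissibleKernel d s lam Lam ρ K) (hs : 0 < s) (hlam : 0 < lam)
    (hρ : 0 ≤ ρ) (hR : ρ < R) {v : Space d → ℝ} {x₀ : Space d} {P q ε N ϱ : ℝ}
    (hx₀ : ‖x₀‖ < R) (hε : 0 < ε) (hεϱ : ε ≤ ϱ) (hP : 0 ≤ P)
    (hvP : v x₀ ≤ P) (hvm : AEMeasurable v) (hvN : ∀ x, |v x| ≤ N)
    {ℓ ζ z : Space d → ℝ} (hℓ : ∀ y, ‖y‖ < ϱ → ζ y = ℓ y)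
    (hζz : ∀ y, ϱ ≤ ‖y‖ → ζ y ≤ z y)
    (hzK : IntegrableOn (fun y => z y * K y) (Metric.ball 0 ϱ)ᶜ)
    (hζK : IntegrableOn (fun y => ζ y * K y) (Metric.ball 0 ε)ᶜ)
    (hKε : IntegrableOn K (Metric.ball 0 ε)ᶜ)
    (hKsq : IntegrableOn (fun y => ‖y‖ ^ 2 * K y) (Metric.ball 0 ϱ))
    (hk : Integrable (tailWeight d s R))
    (h1 : ∀ y, ‖y‖ < ε → v (x₀ + y) = v x₀ + ℓ y - q * ‖y‖ ^ 2)
    (h2 : ∀ y, v x₀ + ℓ y - q * ‖y‖ ^ 2 ≤ v (x₀ + y))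
    (h3 : ∀ y, ε ≤ ‖y‖ → 0 ≤ v (x₀ + y))
    (h4 : ∀ y, v x₀ + ℓ y - q * ‖y‖ ^ 2 ≤ 3 * P) :
    Integrable (fun y => (v (x₀ + y) - v x₀ - ζ y) * K y) ∧
      lam * (∫ x in (Metric.ball x₀ ε)ᶜ, v x * tailWeight d s R x)
        - 3 * P * lam * (∫ x, tailWeight d s R x)
        - q * (∫ y in Metric.ball 0 ϱ, ‖y‖ ^ 2 * K y)
        - P * (∫ y in (Metric.ball 0 ϱ)ᶜ, K y)
        - ∫ y in (Metric.ball 0 ϱ)ᶜ, z y * K y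
      ≤ ∫ y, (v (x₀ + y) - v x₀ - ζ y) * K y := by
  have hR0 : 0 < R := hρ.trans_lt hR
  have hmε : MeasurableSet (Metric.ball (0 : Space d) ε) := Metric.isOpen_ball.measurableSet
  have hmϱ : MeasurableSet (Metric.ball (0 : Space d) ϱ) := Metric.isOpen_ball.measurableSet
  have hmx : MeasurableSet (Metric.ball x₀ ε) := Metric.isOpen_ball.measurableSet
  have hvm' : AEMeasurable (fun y => v (x₀ + y)) :=
    hvm.comp_quasiMeasurePreserving (measurePreserving_add_left volume x₀).quasiMeasurePreserving
  -- Integrability matters: the Bochner integral of a non-integrable function is `0`, and no lower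
  -- bound could be read off.
  have hint : Integrable (fun y => (v (x₀ + y) - v x₀ - ζ y) * K y) := by
    rw [← integrableOn_univ, ← union_compl_self (Metric.ball (0 : Space d) ε)]
    refine IntegrableOn.union ?_ ?_
    · refine ((hKsq.mono_set (Metric.ball_subset_ball hεϱ)).const_mul (-q)).congr ?_
      refine (ae_restrict_iff' hmε).2 (Eventually.of_forall fun y hy => ?_)
      have hy' : ‖y‖ < ε := by simpa using hy
      simp only [h1 y hy', hℓ y (hy'.trans_le hεϱ)]
      ring
    · have hb : IntegrableOn (fun y => (v (x₀ + y) - v x₀) * K y) (Metric.ball 0 ε)ᶜ := by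
        refine (hKε.const_mul (N + N)).mono'
          (((hvm'.sub_const _).mul hK.measurable.aemeasurable).aestronglyMeasurable.restrict)
          (Eventually.of_forall fun y => ?_)
        rw [norm_mul, Real.norm_of_nonneg (hK.nonneg y)]
        refine mul_le_mul_of_nonneg_right ?_ (hK.nonneg y)
        exact (norm_sub_le _ _).trans (add_le_add (hvN _) (hvN _))
      refine (hb.sub hζK).congr (Eventually.of_forall fun y => ?_)
      simp only [Pi.sub_apply]
      ring
  refine ⟨hint, ?_⟩
  have hk' : Integrable (fun y => tailWeight d s R (x₀ + y)) := hk.comp_add_left x₀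
  have hvk : Integrable (fun x => v x * tailWeight d s R x) :=
    hk.bdd_mul (c := N) hvm.aestronglyMeasurable (Eventually.of_forall hvN)
  have hvk' : Integrable (fun y => (Metric.ball x₀ ε)ᶜ.indicator
      (fun x => v x * tailWeight d s R x) (x₀ + y)) := (hvk.indicator hmx.compl).comp_add_left x₀
  have hKϱ : IntegrableOn K (Metric.ball 0 ϱ)ᶜ :=
    hKε.mono_set (compl_subset_compl.2 (Metric.ball_subset_ball hεϱ))
  have e1 : ∫ x in (Metric.ball x₀ ε)ᶜ, v x * tailWeight d s R x =
      ∫ y, (Metric.ball x₀ ε)ᶜ.indicator (fun x => v x * tailWeight d s R x) (x₀ + y) := by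
    rw [← integral_indicator hmx.compl, integral_add_left_eq_self
      ((Metric.ball x₀ ε)ᶜ.indicator (fun x => v x * tailWeight d s R x)) x₀]
  have e2 : ∫ x, tailWeight d s R x = ∫ y, tailWeight d s R (x₀ + y) :=
    (integral_add_left_eq_self _ x₀).symm
  rw [e1, e2, ← integral_indicator hmϱ, ← integral_indicator hmϱ.compl,
    ← integral_indicator hmϱ.compl, ← integral_const_mul, ← integral_const_mul,
    ← integral_const_mul, ← integral_const_mul]
  have i1 := hvk'.const_mul lam
  have i2 := hk'.const_mul (3 * P * lam)
  have i3 := (hKsq.integrable_indicator hmϱ).const_mul q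
  have i4 := (hKϱ.integrable_indicator hmϱ.compl).const_mul P
  have i5 := hzK.integrable_indicator hmϱ.compl
  rw [← integral_sub' i1 i2, ← integral_sub' (i1.sub i2) i3,
    ← integral_sub' ((i1.sub i2).sub i3) i4, ← integral_sub' (((i1.sub i2).sub i3).sub i4) i5]
  refine integral_mono_ae ((((i1.sub i2).sub i3).sub i4).sub i5) hint ?_
  refine Eventually.of_forall fun y => ?_
  simp only [Pi.sub_apply]
  have hmem : x₀ + y ∈ Metric.ball x₀ ε ↔ ‖y‖ < ε := by simp
  have hw := (tailWeight_pos (d := d) (s := s) hR0 (x₀ + y)).le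
  have hKy := hK.nonneg y
  rcases lt_or_ge ‖y‖ ε with hyε | hyε
  · have hyϱ := hyε.trans_le hεϱ
    have m1 : x₀ + y ∉ (Metric.ball x₀ ε)ᶜ := fun h => h (hmem.2 hyε)
    have m2 : y ∈ Metric.ball (0 : Space d) ϱ := by simpa using hyϱ
    have m3 : y ∉ (Metric.ball (0 : Space d) ϱ)ᶜ := fun h => h m2
    simp only [indicator_of_notMem m1, indicator_of_mem m2, indicator_of_notMem m3, h1 y hyε,
      hℓ y hyϱ]
    have : 0 ≤ 3 * P * lam * tailWeight d s R (x₀ + y) := by positivity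
    linarith
  · have hy0 : y ≠ 0 := norm_pos_iff.1 (hε.trans_le hyε)
    have hkK := hK.tailWeight_le hs hlam hρ hR hx₀ hy0
    have hv0 := h3 y hyε
    have m1 : x₀ + y ∈ (Metric.ball x₀ ε)ᶜ := fun h => (hmem.1 h).not_ge hyε
    rcases lt_or_ge ‖y‖ ϱ with hyϱ | hyϱ
    · have m2 : y ∈ Metric.ball (0 : Space d) ϱ := by simpa using hyϱ
      have m3 : y ∉ (Metric.ball (0 : Space d) ϱ)ᶜ := fun h => h m2
      simp only [indicator_of_mem m1, indicator_of_mem m2, indicator_of_notMem m3, hℓ y hyϱ]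
      -- The excess of `v` over the paraboloid is nonnegative, so `K` may be replaced by `lam` times
      -- the weight on it; the paraboloid is then removed at the cost `3P`.
      have e0 := mul_le_mul_of_nonneg_left hkK (sub_nonneg.2 (h2 y))
      have e3 := mul_le_mul_of_nonneg_right (h4 y) (mul_nonneg hlam.le hw)
      linarith
    · have m2 : y ∉ Metric.ball (0 : Space d) ϱ := by simpa using hyϱ
      have m3 : y ∈ (Metric.ball (0 : Space d) ϱ)ᶜ := m2
      simp only [indicator_of_mem m1, indicator_of_notMem m2, indicator_of_mem m3]
      have e0 := mul_le_mul_of_nonneg_left hkK hv0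
      have e3 := mul_le_mul_of_nonneg_right (hζz y hyϱ) hKy
      have e4 := mul_le_mul_of_nonneg_right hvP hKy
      have : 0 ≤ 3 * P * lam * tailWeight d s R (x₀ + y) := by positivity
      linarith

/-- For `s = 1/2` the compensator is cut off at radius `1`, whereas scaling asks for a radius
comparable to `R`. Cancellation on annuli permits a change by powers of two. -/
theorem exists_dyadic_radius {R : ℝ} (hR : 0 < R) :
    ∃ ϱ : ℝ, R ≤ ϱ ∧ ϱ ≤ 2 * R ∧ ∃ n : ℕ, ϱ = 2 ^ n ∨ 2 ^ n * ϱ = 1 := by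
  rcases le_total 1 R with h | h
  · obtain ⟨n, h1, h2⟩ := exists_two_pow_mul_le one_pos h
    exact ⟨2 ^ (n + 1), by rw [pow_succ]; linarith, by rw [pow_succ]; linarith, n + 1, Or.inl rfl⟩
  · obtain ⟨n, h1, h2⟩ := exists_two_pow_mul_le hR h
    refine ⟨(2 ^ n)⁻¹, ?_, ?_, n, Or.inr (mul_inv_cancel₀ (by positivity))⟩
    · rw [← one_div, le_div_iff₀ (by positivity)]; linarith
    · rw [inv_le_iff_one_le_mul₀ (by positivity)]; linarith

/-- For `s = 1/2` the truncation radius in the compensator may be changed by a power of two. -/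
theorem IsAdmissibleKernel.integral_change_radius {d : ℕ} {s lam Lam ρ : ℝ} {K : Space d → ℝ}
    (hK : IsAdmissibleKernel d s lam Lam ρ K) (hLam : 0 < Lam) (hs : s = 1 / 2) {ϱ : ℝ}
    (hϱ : 0 < ϱ) (hn : ∃ n : ℕ, ϱ = 2 ^ n ∨ 2 ^ n * ϱ = 1) (G : Space d) :
    Integrable (fun y => ((Metric.ball 0 ϱ).indicator (fun y => inner ℝ y G) y
      - (Metric.ball 0 1).indicator (fun y => inner ℝ y G) y) * K y) ∧
    ∫ y, ((Metric.ball 0 ϱ).indicator (fun y => inner ℝ y G) y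
      - (Metric.ball 0 1).indicator (fun y => inner ℝ y G) y) * K y = 0 := by
  have main : ∀ (r : ℝ) (n : ℕ), 0 < r →
      Integrable (fun y => ((Metric.ball 0 (2 ^ n * r)).indicator (fun y => inner ℝ y G) y
        - (Metric.ball 0 r).indicator (fun y => inner ℝ y G) y) * K y) ∧
      ∫ y, ((Metric.ball 0 (2 ^ n * r)).indicator (fun y => inner ℝ y G) y
        - (Metric.ball 0 r).indicator (fun y => inner ℝ y G) y) * K y = 0 := by
    intro r n hr
    obtain ⟨hi, h0⟩ := hK.integral_dyadic_shell hLam hs hr n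
    have hm : MeasurableSet (Metric.ball (0 : Space d) (2 ^ n * r) \ Metric.ball 0 r) :=
      Metric.isOpen_ball.measurableSet.diff Metric.isOpen_ball.measurableSet
    have heq : (fun y => ((Metric.ball 0 (2 ^ n * r)).indicator (fun y => inner ℝ y G) y
        - (Metric.ball 0 r).indicator (fun y => inner ℝ y G) y) * K y) =
        (Metric.ball (0 : Space d) (2 ^ n * r) \ Metric.ball 0 r).indicator
          (fun y => inner ℝ G (K y • y)) := by
      funext y
      have hsub : y ∈ Metric.ball (0 : Space d) r → y ∈ Metric.ball (0 : Space d) (2 ^ n * r) :=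
        fun h => Metric.ball_subset_ball
          (le_mul_of_one_le_left hr.le (one_le_pow₀ one_le_two)) h
      by_cases hy : y ∈ Metric.ball (0 : Space d) r
      · have : y ∉ Metric.ball (0 : Space d) (2 ^ n * r) \ Metric.ball 0 r := fun h => h.2 hy
        rw [indicator_of_mem hy, indicator_of_mem (hsub hy), indicator_of_notMem this]
        simp
      · by_cases hy2 : y ∈ Metric.ball (0 : Space d) (2 ^ n * r)
        · have : y ∈ Metric.ball (0 : Space d) (2 ^ n * r) \ Metric.ball 0 r := ⟨hy2, hy⟩
          rw [indicator_of_notMem hy, indicator_of_mem hy2, indicator_of_mem this, inner_smul_right,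
            real_inner_comm, sub_zero, mul_comm]
        · have : y ∉ Metric.ball (0 : Space d) (2 ^ n * r) \ Metric.ball 0 r := fun h => hy2 h.1
          rw [indicator_of_notMem hy, indicator_of_notMem hy2, indicator_of_notMem this]
          simp
    rw [heq, integrable_indicator_iff hm, integral_indicator hm]
    refine ⟨hi.const_inner G, ?_⟩
    rw [integral_inner hi, h0, inner_zero_right]
  obtain ⟨n, h | h⟩ := hn
  · have := main 1 n one_pos
    rwa [mul_one, ← h] at this
  · obtain ⟨h1, h2⟩ := main ϱ n hϱ
    rw [h] at h1 h2
    have e : (fun y => ((Metric.ball 0 ϱ).indicator (fun y => inner ℝ y G) y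
      - (Metric.ball 0 1).indicator (fun y => inner ℝ y G) y) * K y) =
      -(fun y => ((Metric.ball 0 1).indicator (fun y => inner ℝ y G) y
      - (Metric.ball 0 ϱ).indicator (fun y => inner ℝ y G) y) * K y) := by
      funext y
      simp only [Pi.neg_apply]
      ring
    rw [e]
    exact ⟨h1.neg, by rw [integral_neg', h2, neg_zero]⟩

/-- Lower bound for `L_K v (x₀)` when `v` lies above a concave paraboloid touching it at `x₀`. -/
theorem exists_linearOp_lower_bound (d : ℕ) {s lam Lam : ℝ} (hs : 1 / 2 ≤ s) (hs1 : s < 1)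
    (hlam : 0 < lam) (hLam : 0 < Lam) :
    ∃ C : ℝ, 0 ≤ C ∧ ∀ (ρ R : ℝ) (K : Space d → ℝ), 0 ≤ ρ → ρ < R →
      IsAdmissibleKernel d s lam Lam ρ K →
      ∀ (v : Space d → ℝ) (x₀ G : Space d) (P q ε N : ℝ), ‖x₀‖ < R → 0 < ε → ε ≤ R → 0 ≤ P →
      0 ≤ q → q ≤ 4 * P / R ^ 2 → gradient v x₀ = G → ‖G‖ ≤ 6 * P / R → v x₀ ≤ P →
      AEMeasurable v → (∀ x, |v x| ≤ N) →
      (∀ y, ‖y‖ < ε → v (x₀ + y) = v x₀ + inner ℝ y G - q * ‖y‖ ^ 2) →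
      (∀ y, v x₀ + inner ℝ y G - q * ‖y‖ ^ 2 ≤ v (x₀ + y)) →
      (∀ y, ε ≤ ‖y‖ → 0 ≤ v (x₀ + y)) →
      (∀ y, v x₀ + inner ℝ y G - q * ‖y‖ ^ 2 ≤ 3 * P) →
      lam * (∫ x in (Metric.ball x₀ ε)ᶜ, v x * tailWeight d s R x) - C * P * R ^ (-(2 * s))
        ≤ linearOp s K v x₀ := by
  have hs0 : 0 < s := by linarith
  obtain ⟨C0, hC0, H0⟩ := exists_integral_compl_ball_le d (s := s) (lam := lam) (β := 0) hLam le_rfl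
    (by linarith)
  obtain ⟨C2, hC2, H2⟩ := exists_integral_ball_sq_le d (lam := lam) hLam hs1
  obtain ⟨Ck, hCk, Hk⟩ := exists_integral_tailWeight_eq d hs0
  simp only [Real.rpow_zero, one_mul, zero_sub] at H0
  have hpow0 : ∀ R ϱ : ℝ, 0 < R → R ≤ ϱ → ϱ ^ (-(2 * s)) ≤ R ^ (-(2 * s)) := fun R ϱ hR h =>
    Real.rpow_le_rpow_of_nonpos hR h (by linarith)
  have hsq : ∀ (R ϱ P q I : ℝ), 0 < R → 0 < ϱ → ϱ ≤ 2 * R → 0 ≤ P → 0 ≤ q → q ≤ 4 * P / R ^ 2 →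
      I ≤ C2 * ϱ ^ (2 - 2 * s) → q * I ≤ 16 * C2 * P * R ^ (-(2 * s)) := by
    intro R ϱ P q I hR hϱ hϱ2 hP hq hq2 hI
    -- The factor `4` bounds `2^{2-2s}`; together with `q ≤ 4P/R²` it gives the constant `16`.
    have h1 : ϱ ^ (2 - 2 * s) ≤ 4 * (R ^ 2 * R ^ (-(2 * s))) := by
      calc ϱ ^ (2 - 2 * s) ≤ (2 * R) ^ (2 - 2 * s) :=
            Real.rpow_le_rpow hϱ.le hϱ2 (by linarith)
        _ = 2 ^ (2 - 2 * s) * R ^ (2 - 2 * s) := Real.mul_rpow two_pos.le hR.le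
        _ ≤ 2 ^ (2 : ℝ) * R ^ (2 - 2 * s) := by
            gcongr
            · norm_num
            · linarith
        _ = 4 * (R ^ 2 * R ^ (-(2 * s))) := by
            rw [sub_eq_add_neg, Real.rpow_add hR, Real.rpow_two, Real.rpow_two]; norm_num
    calc q * I ≤ q * (C2 * ϱ ^ (2 - 2 * s)) := by gcongr
      _ ≤ (4 * P / R ^ 2) * (C2 * (4 * (R ^ 2 * R ^ (-(2 * s))))) := by gcongr
      _ = 16 * C2 * P * R ^ (-(2 * s)) := by field_simp; ring
  rcases hs.eq_or_lt with hs' | hs'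
  -- Case `s = 1/2`: the first moment at infinity is not controlled, but once the compensator is cut
  -- off at `ϱ` it contributes nothing outside `B_ϱ`, hence `z = 0`.
  · refine ⟨3 * lam * Ck + 16 * C2 + C0, by positivity, ?_⟩
    intro ρ R K hρ hR hK v x₀ G P q ε N hx₀ hε hεR hP hq hq2 hG hGP hvP hvm hvN h1 h2 h3 h4
    have hR0 : 0 < R := hρ.trans_lt hR
    obtain ⟨ϱ, hRϱ, hϱ2, hn⟩ := exists_dyadic_radius hR0
    have hϱ0 := hR0.trans_le hRϱ
    have hmeas : Measurable fun y : Space d => inner ℝ y G :=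
      (continuous_id.inner continuous_const).measurable
    obtain ⟨ci, c0⟩ := hK.integral_change_radius hLam hs'.symm hϱ0 hn G
    have hζK : IntegrableOn (fun y => (Metric.ball 0 ϱ).indicator (fun y => inner ℝ y G) y * K y)
        (Metric.ball 0 ε)ᶜ := by
      refine ((H0 ρ K hK ε hε).1.const_mul (ϱ * ‖G‖)).mono'
        ((hmeas.indicator Metric.isOpen_ball.measurableSet).mul
          hK.measurable).aestronglyMeasurable
        (Eventually.of_forall fun y => ?_)
      rw [norm_mul, Real.norm_of_nonneg (hK.nonneg y)]
      refine mul_le_mul_of_nonneg_right ?_ (hK.nonneg y)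
      by_cases hy : y ∈ Metric.ball (0 : Space d) ϱ
      · rw [indicator_of_mem hy]
        have hy' : ‖y‖ ≤ ϱ := by simpa using (Metric.ball_subset_closedBall hy)
        exact (norm_inner_le_norm _ _).trans (by gcongr)
      · rw [indicator_of_notMem hy, norm_zero]; positivity
    obtain ⟨hi, hle⟩ := hK.lower_bound_of_paraboloid hs0 hlam hρ hR hx₀ hε (hεR.trans hRϱ) hP hvP hvm
      hvN (ℓ := fun y => inner ℝ y G) (ζ := (Metric.ball 0 ϱ).indicator (fun y => inner ℝ y G))
      (z := fun _ => 0)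
      (fun y hy => indicator_of_mem (by simpa using hy) _)
      (fun y hy => (indicator_of_notMem (by simpa using hy) _).le)
      (by simp) hζK (H0 ρ K hK ε hε).1 (H2 ρ K hK ϱ hϱ0).1 (Hk R hR0).1 h1 h2 h3 h4
    have hlin : linearOp s K v x₀ =
        ∫ y, (v (x₀ + y) - v x₀ - (Metric.ball 0 ϱ).indicator (fun y => inner ℝ y G) y) * K y := by
      rw [← add_zero (∫ y, _), ← c0, ← integral_add hi ci, linearOp]
      congr 1
      funext y
      have : diffOp s v x₀ y = v (x₀ + y) - v x₀
          - (Metric.ball 0 1).indicator (fun y => inner ℝ y G) y := by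
        rw [diffOp, if_neg (by linarith), if_pos hs'.symm, hG]
        simp only [indicator]
      rw [this]
      ring
    rw [hlin]
    refine le_trans ?_ hle
    have b2 := hsq R ϱ P q _ hR0 hϱ0 hϱ2 hP hq hq2 (H2 ρ K hK ϱ hϱ0).2
    have b0 := mul_le_mul_of_nonneg_left ((H0 ρ K hK ϱ hϱ0).2.trans
      (mul_le_mul_of_nonneg_left (hpow0 R ϱ hR0 hRϱ) hC0)) hP
    rw [(Hk R hR0).2]
    simp only [zero_mul, integral_zero]
    linarith
  -- Case `s > 1/2`: now `1 < 2s`, so the first moment outside `B_R` is finite and controls the full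
  -- linear compensator.
  · obtain ⟨C1, hC1, H1⟩ := exists_integral_compl_ball_le d (s := s) (lam := lam) (β := 1) hLam
      zero_le_one (by linarith)
    simp only [Real.rpow_one] at H1
    refine ⟨3 * lam * Ck + 16 * C2 + C0 + 6 * C1, by positivity, ?_⟩
    intro ρ R K hρ hR hK v x₀ G P q ε N hx₀ hε hεR hP hq hq2 hG hGP hvP hvm hvN h1 h2 h3 h4
    have hR0 : 0 < R := hρ.trans_lt hR
    have hmeas : Measurable fun y : Space d => inner ℝ y G :=
      (continuous_id.inner continuous_const).measurable
    have hG' : ∀ y : Space d, ‖inner ℝ y G‖ ≤ ‖G‖ * ‖y‖ := fun y => by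
      rw [mul_comm]; exact norm_inner_le_norm _ _
    have hζK : IntegrableOn (fun y => inner ℝ y G * K y) (Metric.ball 0 ε)ᶜ := by
      refine ((H1 ρ K hK ε hε).1.const_mul ‖G‖).mono'
        (hmeas.mul hK.measurable).aestronglyMeasurable (Eventually.of_forall fun y => ?_)
      rw [norm_mul, Real.norm_of_nonneg (hK.nonneg y), ← mul_assoc]
      exact mul_le_mul_of_nonneg_right (hG' y) (hK.nonneg y)
    obtain ⟨-, hle⟩ := hK.lower_bound_of_paraboloid hs0 hlam hρ hR hx₀ hε hεR hP hvP hvm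
      hvN (ℓ := fun y => inner ℝ y G) (ζ := fun y => inner ℝ y G)
      (z := fun y => ‖G‖ * ‖y‖) (fun y _ => rfl)
      (fun y _ => (le_abs_self _).trans (hG' y))
      (by simp only [mul_assoc]; exact (H1 ρ K hK R hR0).1.const_mul ‖G‖)
      hζK (H0 ρ K hK ε hε).1 (H2 ρ K hK R hR0).1 (Hk R hR0).1 h1 h2 h3 h4
    have hlin : linearOp s K v x₀ = ∫ y, (v (x₀ + y) - v x₀ - inner ℝ y G) * K y := by
      rw [linearOp]
      congr 1
      funext y
      rw [diffOp, if_neg (by linarith), if_neg hs'.ne', hG]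
    rw [hlin]
    refine le_trans ?_ hle
    have b2 := hsq R R P q _ hR0 hR0 (by linarith) hP hq hq2 (H2 ρ K hK R hR0).2
    have b0 := mul_le_mul_of_nonneg_left (H0 ρ K hK R hR0).2 hP
    have b1 : ∫ y in (Metric.ball 0 R)ᶜ, ‖G‖ * ‖y‖ * K y ≤ 6 * C1 * P * R ^ (-(2 * s)) := by
      simp only [mul_assoc]
      rw [integral_const_mul]
      calc ‖G‖ * ∫ y in (Metric.ball 0 R)ᶜ, ‖y‖ * K y
          ≤ (6 * P / R) * (C1 * R ^ (1 - 2 * s)) :=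
            mul_le_mul hGP (H1 ρ K hK R hR0).2
              (integral_nonneg fun y => mul_nonneg (norm_nonneg _) (hK.nonneg y)) (by positivity)
        _ = 6 * (C1 * (P * R ^ (-(2 * s)))) := by
            rw [sub_eq_add_neg, Real.rpow_add hR0, Real.rpow_one]
            field_simp
    rw [(Hk R hR0).2]
    linarith

/-! ### The viscosity inequality at a contact point -/

theorem hasGradientAt_paraboloid {d : ℕ} (a b : ℝ) (x : Space d) :
    HasGradientAt (fun z : Space d => a - b * ‖z‖ ^ 2) (-(2 * b) • x) x := by
  rw [hasGradientAt_iff_hasFDerivAt]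
  have h := (((hasStrictFDerivAt_norm_sq x).hasFDerivAt).const_mul b).const_sub a
  refine h.congr_fderiv ?_
  ext y
  simp
  ring

theorem isTestFunction_paraboloid {d : ℕ} {A B : ℝ → ℝ} (hA : Differentiable ℝ A)
    (hB : Differentiable ℝ B) (x₀ : Space d) (t₀ ε : ℝ) :
    IsTestFunction x₀ t₀ ε (fun x t => A t - B t * ‖x‖ ^ 2) where
  left_differentiable x _ t _ :=
    ((hA t).sub ((hB t).mul_const _)).differentiableWithinAt
  differentiable t _ x _ := (hasGradientAt_paraboloid (A t) (B t) x).differentiableAt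
  gradient_lipschitz t _ := by
    refine ⟨‖-(2 * B t)‖₊, ?_⟩
    have : (fun x : Space d => gradient (fun z : Space d => A t - B t * ‖z‖ ^ 2) x) =
        fun x => -(2 * B t) • x := by
      funext x
      exact (hasGradientAt_paraboloid (A t) (B t) x).gradient
    rw [this]
    exact (lipschitzWith_smul (-(2 * B t))).lipschitzOnWith

/-- The viscosity inequality at a point where a paraboloid touches the supersolution from below. -/
theorem exists_contact_inequality (d : ℕ) (hd : 1 ≤ d) {s lam Lam : ℝ} (hs : 1 / 2 ≤ s)
    (hs1 : s < 1) (hlam : 0 < lam) (hLam : 0 < Lam) :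
    ∃ C : ℝ, 0 ≤ C ∧ ∀ (ρ R f₀ : ℝ) (u : Space d → ℝ → ℝ), 0 ≤ ρ → ρ < R →
      (∀ x, ∀ t ∈ timeInterval s R, 0 ≤ u x t) →
      IsViscositySupersolution (driftPucciMin s lam Lam ρ) (Metric.ball (0 : Space d) R)
        (timeInterval s R) (fun _ _ => f₀) u →
      ∀ (x₀ : Space d) (t₀ ε₀ P D : ℝ) (A B : ℝ → ℝ), x₀ ∈ Metric.ball 0 R →
      t₀ ∈ timeInterval s R → 0 < ε₀ → Differentiable ℝ A → Differentiable ℝ B →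
      HasDerivAt (fun t => A t - B t * ‖x₀‖ ^ 2) D t₀ →
      A t₀ - B t₀ * ‖x₀‖ ^ 2 = u x₀ t₀ →
      (∀ x ∈ Metric.ball x₀ ε₀, ∀ t ∈ Ioc (t₀ - ε₀) t₀, A t - B t * ‖x‖ ^ 2 ≤ u x t) →
      (∀ x, A t₀ - B t₀ * ‖x‖ ^ 2 ≤ u x t₀) →
      0 ≤ P → 0 ≤ B t₀ → B t₀ ≤ 4 * P / R ^ 2 → 2 * B t₀ * ‖x₀‖ ≤ 6 * P / R → u x₀ t₀ ≤ P →
      A t₀ ≤ 3 * P →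
      f₀ ≤ D + Lam * (6 * P / R) + C * P * R ^ (-(2 * s))
        - lam * ∫ x, u x t₀ * tailWeight d s R x := by
  obtain ⟨C, hC, H⟩ := exists_linearOp_lower_bound d hs hs1 hlam hLam
  refine ⟨C, hC, ?_⟩
  intro ρ R f₀ u hρ hR hu0 hu x₀ t₀ ε₀ P D A B hx₀ ht₀ hε₀ hA hB hD heq hloc hglob hP hB0 hBP hGP
    huP hAP
  have hR0 : 0 < R := hρ.trans_lt hR
  have hx₀' : ‖x₀‖ < R := by simpa using hx₀
  obtain ⟨Ck, -, Hk⟩ := exists_integral_tailWeight_eq d (s := s) (by linarith)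
  obtain ⟨N, hN⟩ := hu.bounded_measurable.bounded
  have hum := hu.bounded_measurable.aemeasurable_slice t₀ ht₀
  -- the inequality with a small ball removed from the integral
  have key : ∀ ε : ℝ, 0 < ε → ε ≤ ε₀ → ε ≤ R - ‖x₀‖ → ε ≤ t₀ + R ^ (2 * s) →
      f₀ ≤ D + Lam * (6 * P / R) + C * P * R ^ (-(2 * s))
        - lam * ∫ x in (Metric.ball x₀ ε)ᶜ, u x t₀ * tailWeight d s R x := by
    intro ε hε hε1 hε2 hε3
    have hεR : ε ≤ R := by linarith [norm_nonneg x₀]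
    have hsubx : Metric.ball x₀ ε ⊆ Metric.ball x₀ ε₀ := Metric.ball_subset_ball hε1
    set φ : Space d → ℝ → ℝ := fun x t => A t - B t * ‖x‖ ^ 2 with hφ
    have hmem : t₀ ∈ Ioc (t₀ - ε) t₀ := ⟨by linarith, le_rfl⟩
    set v : Space d → ℝ := fun x => patch x₀ t₀ ε φ u x t₀ with hv
    have hvin : ∀ x ∈ Metric.ball x₀ ε, v x = A t₀ - B t₀ * ‖x‖ ^ 2 := fun x hx => by
      simp only [hv, patch, hφ, if_pos (And.intro hx hmem)]
    have hvout : ∀ x ∉ Metric.ball x₀ ε, v x = u x t₀ := fun x hx => by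
      simp only [hv, patch, hx, false_and, if_false]
    have hx₀ε : x₀ ∈ Metric.ball x₀ ε := Metric.mem_ball_self hε
    have hvx₀ : v x₀ = u x₀ t₀ := by rw [hvin x₀ hx₀ε, heq]
    have hvge : ∀ x, A t₀ - B t₀ * ‖x‖ ^ 2 ≤ v x := fun x => by
      by_cases hx : x ∈ Metric.ball x₀ ε
      · exact (hvin x hx).ge
      · rw [hvout x hx]; exact hglob x
    have hgrad : gradient v x₀ = -(2 * B t₀) • x₀ := by
      have h := hasGradientAt_paraboloid (A t₀) (B t₀) x₀
      have he : v =ᶠ[𝓝 x₀] fun z : Space d => A t₀ - B t₀ * ‖z‖ ^ 2 := by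
        filter_upwards [Metric.ball_mem_nhds x₀ hε] with x hx using hvin x hx
      exact (h.congr_of_eventuallyEq he).gradient
    have hGn : ‖gradient v x₀‖ ≤ 6 * P / R := by
      rw [hgrad, norm_smul, norm_neg, Real.norm_of_nonneg (by positivity)]
      exact hGP
    have hexp : ∀ y, v x₀ + inner ℝ y (-(2 * B t₀) • x₀) - B t₀ * ‖y‖ ^ 2 =
        A t₀ - B t₀ * ‖x₀ + y‖ ^ 2 := fun y => by
      rw [hvin x₀ hx₀ε, norm_add_sq_real, inner_smul_right, real_inner_comm]
      ring
    have hvm : AEMeasurable v := by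
      have hc : Continuous fun x : Space d => A t₀ - B t₀ * ‖x‖ ^ 2 := by fun_prop
      rw [← Measure.restrict_univ (μ := volume), ← union_compl_self (Metric.ball x₀ ε),
        aemeasurable_union_iff]
      have hm : MeasurableSet (Metric.ball x₀ ε) := Metric.isOpen_ball.measurableSet
      refine ⟨hc.aemeasurable.congr ?_, hum.restrict.congr ?_⟩
      · exact (ae_restrict_iff' hm).2 (Eventually.of_forall fun x hx => (hvin x hx).symm)
      · exact (ae_restrict_iff' hm.compl).2 (Eventually.of_forall fun x hx => (hvout x hx).symm)
    have hvN : ∀ x, |v x| ≤ max N (|A t₀| + B t₀ * R ^ 2) := fun x => by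
      by_cases hx : x ∈ Metric.ball x₀ ε
      · rw [hvin x hx]
        have hxR : ‖x‖ ≤ R := by
          have h1 : ‖x - x₀‖ < ε := by simpa [dist_eq_norm] using hx
          have h2 : ‖x‖ ≤ ‖x - x₀‖ + ‖x₀‖ := by simpa using norm_add_le (x - x₀) x₀
          linarith
        refine le_max_of_le_right ((abs_sub _ _).trans ?_)
        rw [abs_of_nonneg (a := B t₀ * ‖x‖ ^ 2) (by positivity)]
        gcongr
      · rw [hvout x hx]
        exact le_max_of_le_left (hN x t₀ ht₀)
    have hsub : Metric.ball x₀ ε ×ˢ Ioc (t₀ - ε) t₀ ⊆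
        Metric.ball (0 : Space d) R ×ˢ timeInterval s R := by
      refine prod_mono ?_ ?_
      · refine Metric.ball_subset_ball' ?_
        rw [dist_zero_right]; linarith
      · exact Ioc_subset_Ioc (by linarith) ht₀.2
    have hvis := hu.supersolution x₀ hx₀ t₀ ht₀ ε hε hsub φ (isTestFunction_paraboloid hA hB _ _ _)
      heq (fun x hx t ht => hloc x (hsubx hx) t ⟨by linarith [ht.1], ht.2⟩)
    have hderiv : derivWithin (fun τ => patch x₀ t₀ ε φ u x₀ τ) (Iic t₀) t₀ = D := by
      refine HasDerivWithinAt.derivWithin ?_ (uniqueDiffWithinAt_Iic t₀)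
      refine hD.hasDerivWithinAt.congr_of_eventuallyEq ?_ (by simp [patch, hx₀ε, hmem, hφ])
      have : Ioc (t₀ - ε) t₀ ∈ 𝓝[Iic t₀] t₀ := Ioc_mem_nhdsLE (by linarith)
      filter_upwards [this] with τ hτ
      simp only [patch, hφ, if_pos (And.intro hx₀ε hτ)]
    -- The bound holds for each kernel with the same constant, so it passes to the infimum,
    -- including the value `+∞` of an empty class.
    have hF : (((lam * (∫ x in (Metric.ball x₀ ε)ᶜ, v x * tailWeight d s R x)
        - C * P * R ^ (-(2 * s))) - Lam * (6 * P / R) : ℝ) : EReal) ≤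
        driftPucciMin s lam Lam ρ v x₀ := by
      rw [driftPucciMin, EReal.coe_sub]
      refine EReal.sub_le_sub (le_iInf fun K => ?_) ?_
      · rw [EReal.coe_le_coe_iff]
        refine H ρ R K.1 hρ hR K.2 v x₀ _ P (B t₀) ε _ hx₀' hε hεR hP hB0 hBP hgrad
          (hgrad ▸ hGn) (hvx₀.trans_le huP) hvm hvN (fun y hy => ?_) (fun y => ?_) (fun y hy => ?_)
          (fun y => ?_)
        · rw [hexp, hvin]; simpa using hy
        · rw [hexp]; exact hvge _
        · rw [hvout]
          · exact hu0 _ _ ht₀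
          · simpa using hy
        · rw [hexp]
          have : 0 ≤ B t₀ * ‖x₀ + y‖ ^ 2 := by positivity
          linarith
      · rw [EReal.coe_le_coe_iff]
        exact mul_le_mul_of_nonneg_left hGn hLam.le
    have hfin := hvis.trans (EReal.sub_le_sub le_rfl hF)
    rw [hderiv, ← EReal.coe_sub, EReal.coe_le_coe_iff] at hfin
    have hI : ∫ x in (Metric.ball x₀ ε)ᶜ, v x * tailWeight d s R x =
        ∫ x in (Metric.ball x₀ ε)ᶜ, u x t₀ * tailWeight d s R x :=
      setIntegral_congr_fun Metric.isOpen_ball.measurableSet.compl fun x hx => by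
        simp only [hvout x hx]
    rw [hI] at hfin
    linarith
  -- let the radius of the removed ball tend to zero
  have hpos : 0 < min ε₀ (min (R - ‖x₀‖) (t₀ + R ^ (2 * s))) :=
    lt_min hε₀ (lt_min (by linarith) (by linarith [ht₀.1]))
  set δ := min ε₀ (min (R - ‖x₀‖) (t₀ + R ^ (2 * s))) with hδ
  have hint : Integrable (fun x => u x t₀ * tailWeight d s R x) :=
    (Hk R hR0).1.bdd_mul (c := N) hum.aestronglyMeasurable
      (Eventually.of_forall fun x => hN x t₀ ht₀)
  have hUnion : ⋃ n : ℕ, (Metric.ball x₀ (δ / (n + 1)))ᶜ = {x₀}ᶜ := by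
    ext x
    simp only [mem_iUnion, mem_compl_iff, Metric.mem_ball, mem_singleton_iff, not_lt]
    constructor
    · rintro ⟨n, hn⟩ rfl
      rw [dist_self] at hn
      have : 0 < δ / (n + 1) := by positivity
      linarith
    · intro hx
      have hdx : 0 < dist x x₀ := dist_pos.2 hx
      obtain ⟨n, hn⟩ := exists_nat_gt (δ / dist x x₀)
      refine ⟨n, ?_⟩
      rw [div_lt_iff₀ hdx] at hn
      rw [div_le_iff₀ (by positivity)]
      nlinarith
  have hlim := tendsto_setIntegral_of_monotone (μ := volume)
    (s := fun n : ℕ => (Metric.ball x₀ (δ / (n + 1)))ᶜ)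
    (f := fun x => u x t₀ * tailWeight d s R x)
    (fun n => Metric.isOpen_ball.measurableSet.compl)
    (fun m n hmn => compl_subset_compl.2 (Metric.ball_subset_ball (by gcongr)))
    hint.integrableOn
  -- For `d ≥ 1` the point `x₀` is null, so the integrals over the complements of the shrinking
  -- balls converge to the full integral.
  have : Nonempty (Fin d) := ⟨⟨0, hd⟩⟩
  rw [hUnion, MeasureTheory.restrict_compl_singleton] at hlim
  refine ge_of_tendsto ((hlim.const_mul lam).const_sub _) (Eventually.of_forall fun n => ?_)
  have hle : δ / (n + 1) ≤ δ := div_le_self hpos.le (by linarith [n.cast_nonneg (α := ℝ)])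
  exact key _ (by positivity) (hle.trans (min_le_left _ _))
    (hle.trans ((min_le_right _ _).trans (min_le_left _ _)))
    (hle.trans ((min_le_right _ _).trans (min_le_right _ _)))

/-! ### The barrier and the comparison argument -/

/-- On `B_{R/2}` the weight is at least `(2R)^{-d-2s}` and the ball has volume of order `R^d`.
Applied to `u(·, t₀)`, this makes the tail integral large when the contact point lies near the edge
of the barrier. -/
theorem exists_le_integral_mul_tailWeight (d : ℕ) {s : ℝ} (hs : 0 < s) :
    ∃ ω : ℝ, 0 < ω ∧ ∀ (R β : ℝ) (w : Space d → ℝ), 0 < R →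
      Integrable (fun x => w x * tailWeight d s R x) → (∀ x, 0 ≤ w x) →
      (∀ x ∈ Metric.ball (0 : Space d) (R / 2), β ≤ w x) →
      β * ω * R ^ (-(2 * s)) ≤ ∫ x, w x * tailWeight d s R x := by
  have hvol : 0 < volume.real (Metric.ball (0 : Space d) 1) :=
    ENNReal.toReal_pos (Metric.measure_ball_pos _ _ one_pos).ne' measure_ball_lt_top.ne
  refine ⟨2 ^ (-((d : ℝ) + 2 * s)) * (2 ^ d)⁻¹ * volume.real (Metric.ball (0 : Space d) 1),
    by positivity, fun R β w hR hint hw hβ => ?_⟩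
  have hwk : ∀ x, 0 ≤ w x * tailWeight d s R x :=
    fun x => mul_nonneg (hw x) (tailWeight_pos hR x).le
  rcases le_or_gt β 0 with hβ0 | hβ0
  · refine le_trans ?_ (integral_nonneg hwk)
    have : 0 ≤ 2 ^ (-((d : ℝ) + 2 * s)) * (2 ^ d)⁻¹ * volume.real (Metric.ball (0 : Space d) 1) *
      R ^ (-(2 * s)) := by positivity
    rw [mul_assoc]
    exact mul_nonpos_of_nonpos_of_nonneg hβ0 this
  · have hball : volume.real (Metric.ball (0 : Space d) (R / 2)) =
        (R / 2) ^ d * volume.real (Metric.ball (0 : Space d) 1) := by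
      rw [Measure.real, Measure.addHaar_ball_of_pos volume _ (by positivity), ENNReal.toReal_mul,
        ENNReal.toReal_ofReal (by positivity), finrank_euclideanSpace, Fintype.card_fin]
      rfl
    calc β * (2 ^ (-((d : ℝ) + 2 * s)) * (2 ^ d)⁻¹ * volume.real (Metric.ball (0 : Space d) 1)) *
          R ^ (-(2 * s))
        = (β * (2 * R) ^ (-((d : ℝ) + 2 * s))) *
            volume.real (Metric.ball (0 : Space d) (R / 2)) := by
          rw [hball, Real.mul_rpow two_pos.le hR.le, neg_add, Real.rpow_add hR,
            Real.rpow_neg hR.le (d : ℝ), Real.rpow_natCast, div_pow]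
          field_simp
      _ ≤ ∫ x in Metric.ball (0 : Space d) (R / 2), w x * tailWeight d s R x := by
          refine setIntegral_ge_of_const_le_real Metric.isOpen_ball.measurableSet
            measure_ball_lt_top.ne (fun x hx => ?_) hint.integrableOn
          have hx' : ‖x‖ < R / 2 := by simpa using hx
          refine mul_le_mul (hβ x hx) ?_ (by positivity) (hw x)
          refine Real.rpow_le_rpow_of_nonpos (by positivity) (by linarith) ?_
          have : (0 : ℝ) ≤ d := d.cast_nonneg
          linarith
      _ ≤ ∫ x, w x * tailWeight d s R x :=
          setIntegral_le_integral hint (Eventually.of_forall hwk)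

/-- The paraboloid `1 - |x|² / r²` with `r = 3R/4`. -/
def paraboloid (d : ℕ) (R : ℝ) (x : Space d) : ℝ := 1 - 16 / 9 / R ^ 2 * ‖x‖ ^ 2

theorem paraboloid_le_one {d : ℕ} (R : ℝ) (x : Space d) : paraboloid d R x ≤ 1 := by
  have : 0 ≤ 16 / 9 / R ^ 2 * ‖x‖ ^ 2 := by positivity
  rw [paraboloid]; linarith

theorem continuous_paraboloid (d : ℕ) (R : ℝ) : Continuous (paraboloid d R) := by
  unfold paraboloid; fun_prop

theorem paraboloid_pos_iff {d : ℕ} {R : ℝ} (hR : 0 < R) (x : Space d) :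
    0 < paraboloid d R x ↔ ‖x‖ < 3 / 4 * R := by
  rw [← sq_lt_sq₀ (norm_nonneg x) (by positivity), paraboloid, sub_pos, div_div, div_mul_eq_mul_div,
    div_lt_one (by positivity)]
  constructor <;> intro h <;> nlinarith

theorem half_le_paraboloid {d : ℕ} {R : ℝ} (hR : 0 < R) {x : Space d} (hx : ‖x‖ < R / 2) :
    1 / 2 ≤ paraboloid d R x := by
  have h := (sq_lt_sq₀ (norm_nonneg x) (by positivity)).2 hx
  rw [paraboloid, le_sub_comm, div_div, div_mul_eq_mul_div, div_le_iff₀ (by positivity)]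
  nlinarith

/-- The left side is the tangent at `q` to the convex function `p ↦ p₊²`. Its slope `2q` makes the
derivatives of the touching paraboloid degenerate near the edge of the barrier's support. -/
theorem tangent_le_sq_posPart {p q : ℝ} (hq : 0 ≤ q) : q * (2 * p - q) ≤ max 0 p ^ 2 := by
  rcases le_total 0 p with h | h
  · rw [max_eq_right h]; nlinarith [sq_nonneg (p - q)]
  · rw [max_eq_left h]; nlinarith

/-- Half of `lam f` absorbs the growth term `c e γ p²` up to `η/2`; the other half is at least
`(M/T)(σ - 4σp²)`. With this `κ` the terms in `M` sum to at most `-(M/T)(2σ - Cp)²/(4σ) ≤ 0`, and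
`-η + η/2 < 0` remains. -/
theorem barrier_contradiction {κ C σ M T p f η c e γ a' D lam I : ℝ} (hσ : 0 < σ) (hM : 0 ≤ M)
    (hT : 0 < T) (hp : 0 ≤ p) (hp1 : p ≤ 1) (hη : 0 < η) (hlam : 0 < lam) (hc : c = lam / 2)
    (he0 : 0 ≤ e) (he : e ≤ 1) (hf : 0 ≤ f) (hγ : γ ≤ f + η / lam)
    (hκ : κ = 4 * σ + C ^ 2 / (4 * σ))
    (hD : D = (-(κ / T) * M + c * e * γ) * p ^ 2 - (a' + η))
    (hfM : (M / 4 - M * p ^ 2) * (8 * σ / lam) / T ≤ f) (hI : I ≤ C * (M * p) / T)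
    (h : -a' ≤ D + I - lam * f) : False := by
  have hp2 : p ^ 2 ≤ 1 := pow_le_one₀ hp hp1
  have h1 : c * e * γ * p ^ 2 ≤ lam / 2 * f + η / 2 := by
    have hx : 0 ≤ f + η / lam := by positivity
    calc c * e * γ * p ^ 2 ≤ c * e * (f + η / lam) * p ^ 2 := by
          have : 0 ≤ c := by rw [hc]; positivity
          gcongr
      _ ≤ c * 1 * (f + η / lam) * 1 := by
          have : 0 ≤ c := by rw [hc]; positivity
          gcongr
      _ = lam / 2 * f + η / 2 := by rw [hc]; field_simp
  have h2 : (M / T) * (σ - 4 * σ * p ^ 2) ≤ lam / 2 * f := by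
    have := mul_le_mul_of_nonneg_left hfM (half_pos hlam).le
    refine le_trans (le_of_eq ?_) this
    field_simp
    ring
  have h3 : 0 ≤ (M / T) * (σ - C * p + C ^ 2 / (4 * σ) * p ^ 2) := by
    refine mul_nonneg (by positivity) ?_
    have : σ - C * p + C ^ 2 / (4 * σ) * p ^ 2 = (2 * σ - C * p) ^ 2 / (4 * σ) := by
      field_simp; ring
    rw [this]; positivity
  have h4 : C * (M * p) / T = (M / T) * (C * p) := by ring
  have h5 : -(κ / T) * M * p ^ 2 = -((M / T) * (κ * p ^ 2)) := by ring
  have h6 : D = -((M / T) * (κ * p ^ 2)) + c * e * γ * p ^ 2 - (a' + η) := by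
    rw [hD, ← h5]; ring
  rw [hκ] at h6
  nlinarith

/-- The primitive of `g` need not be differentiable at `t₀`. A linear function of slope `γ` lies
below it to the left of `t₀` and can serve in the test function. -/
theorem primitive_le_tangent {g : ℝ → NNReal} (hg : Integrable fun t => (g t : ℝ)) {b t t₀ γ : ℝ}
    (ht : t ≤ t₀) (hγ : ∀ τ ∈ Icc t t₀, (g τ : ℝ) ≤ γ) :
    (∫ τ in b..t₀, (g τ : ℝ)) - γ * (t₀ - t) ≤ ∫ τ in b..t, (g τ : ℝ) := by
  have hi : ∀ x y, IntervalIntegrable (fun τ => (g τ : ℝ)) volume x y :=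
    fun x y => hg.intervalIntegrable
  have h1 := intervalIntegral.integral_add_adjacent_intervals (hi b t) (hi t t₀)
  have h2 : ∫ τ in t..t₀, (g τ : ℝ) ≤ ∫ _ in t..t₀, γ :=
    intervalIntegral.integral_mono_on ht (hi t t₀) intervalIntegrable_const hγ
  rw [intervalIntegral.integral_const, smul_eq_mul] at h2
  linarith

set_option maxHeartbeats 1000000 in
/-- Comparison of a supersolution with the explicit barrier. -/
theorem exists_barrier_le (d : ℕ) (hd : 1 ≤ d) {s lam Lam R₀ : ℝ} (hs : 1 / 2 ≤ s) (hs1 : s < 1)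
    (hlam : 0 < lam) (hLam : 0 < Lam) (hR₀ : 0 < R₀) :
    ∃ κ : ℝ, 0 < κ ∧ ∀ (ρ R a : ℝ) (u : Space d → ℝ → ℝ), 0 ≤ ρ → ρ < R → R ≤ R₀ → 0 ≤ a →
      (∀ x, ∀ t ∈ timeInterval s R, 0 ≤ u x t) →
      IsViscositySupersolution (driftPucciMin s lam Lam ρ) (Metric.ball (0 : Space d) R)
        (timeInterval s R) (fun _ _ => -(R ^ (-(2 * s)) * a)) u →
      ∀ (g : ℝ → NNReal) (η : ℝ), UpperSemicontinuous g → Integrable (fun t => (g t : ℝ)) →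
      (∀ t ∈ timeInterval s R, (g t : ℝ) ≤ ∫ x, u x t * tailWeight d s R x) → 0 < η →
      ∀ x ∈ Metric.ball (0 : Space d) (3 / 4 * R), ∀ t ∈ timeInterval s R,
        lam / 2 * Real.exp (-κ * ((t + R ^ (2 * s)) / R ^ (2 * s))) *
          (∫ τ in (-(R ^ (2 * s)))..t, (g τ : ℝ)) * paraboloid d R x ^ 2
          - (R ^ (-(2 * s)) * a + η) * (t + R ^ (2 * s)) - η ≤ u x t := by
  have hs0 : 0 < s := by linarith
  obtain ⟨C, hC, H⟩ := exists_contact_inequality d hd hs hs1 hlam hLam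
  obtain ⟨ω, hω, Hω⟩ := exists_le_integral_mul_tailWeight d hs0
  obtain ⟨Ck, -, Hk⟩ := exists_integral_tailWeight_eq d hs0
  -- The drift costs `6 Lam P/R = 6 Lam P R^{2s-1}/T`; since `2s - 1 ≥ 0`, the bound `R ≤ R₀` makes
  -- this uniform. The value of `σ` comes from `(lam/2) · ω · (M/4) = σ M`.
  set C' : ℝ := 6 * Lam * R₀ ^ (2 * s - 1) + C with hC'
  set σ : ℝ := lam * ω / 8 with hσ
  have hσ0 : 0 < σ := by positivity
  refine ⟨4 * σ + C' ^ 2 / (4 * σ), by positivity, ?_⟩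
  set κ : ℝ := 4 * σ + C' ^ 2 / (4 * σ) with hκ
  intro ρ R a u hρ hR hRR₀ ha hu0 hu g η hgusc hgint hgf hη
  have hR0 : 0 < R := hρ.trans_lt hR
  have hTinv : R ^ (-(2 * s)) = (R ^ (2 * s))⁻¹ := Real.rpow_neg hR0.le _
  have hTdef : timeInterval s R = Ioc (-(R ^ (2 * s))) 0 := rfl
  set T : ℝ := R ^ (2 * s) with hT
  have hT0 : 0 < T := by positivity
  set α : ℝ := R ^ (-(2 * s)) * a + η with hα
  have hα0 : 0 < α := by positivity
  set G : ℝ → ℝ := fun t => ∫ τ in (-T)..t, (g τ : ℝ) with hG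
  have hGc : Continuous G :=
    intervalIntegral.continuous_primitive (fun _ _ => hgint.intervalIntegrable) _
  set E : ℝ → ℝ := fun t => lam / 2 * Real.exp (-κ * ((t + T) / T)) with hE
  have hEc : Continuous E := by fun_prop
  have hE0 : ∀ t, 0 < E t := fun t => by positivity
  set p := paraboloid d R with hp
  have hpc : Continuous p := continuous_paraboloid d R
  have hp1 : ∀ x, p x ≤ 1 := paraboloid_le_one R
  -- Outside the ball of radius `3R/4` the profile vanishes and the barrier is negative, so a
  -- negative minimum lies strictly inside.
  set b : Space d → ℝ := fun x => max 0 (p x) ^ 2 with hb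
  have hbc : Continuous b := by fun_prop
  have hb1 : ∀ x, b x ≤ 1 := fun x =>
    pow_le_one₀ (le_max_left _ _) (max_le zero_le_one (hp1 x))
  have hbz : ∀ x, p x ≤ 0 → b x = 0 := fun x hx => by simp [hb, max_eq_left hx]
  have hbp : ∀ x, 0 ≤ p x → b x = p x ^ 2 := fun x hx => by simp [hb, max_eq_right hx]
  have hGnn : ∀ t ∈ Ioc (-T) 0, 0 ≤ G t := fun t ht =>
    intervalIntegral.integral_nonneg ht.1.le fun _ _ => NNReal.coe_nonneg _
  set φ : Space d → ℝ → ℝ := fun x t => E t * G t * b x - α * (t + T) - η with hφ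
  have hφz : ∀ x, p x ≤ 0 → ∀ t ∈ Ioc (-T) 0, φ x t < 0 := fun x hx t ht => by
    simp only [hφ, hbz x hx, mul_zero]
    have : 0 ≤ α * (t + T) := mul_nonneg hα0.le (by linarith [ht.1])
    linarith
  intro xs hxs ts hts
  rw [hTdef] at hts hgf
  by_contra hcon
  have hps : 0 < p xs := (paraboloid_pos_iff hR0 xs).2 (by simpa using hxs)
  have hneg : u xs ts - φ xs ts < 0 := by
    simp only [hφ, hbp xs hps.le]
    have hcon' : u xs ts < E ts * G ts * p xs ^ 2 - α * (ts + T) - η := not_le.1 hcon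
    linarith
  -- near the initial time the barrier is negative
  obtain ⟨t₁, ht₁, ht₁s, hφ1⟩ : ∃ t₁, -T < t₁ ∧ t₁ ≤ ts ∧ ∀ x, φ x t₁ < 0 := by
    have hc : Tendsto (fun t => E t * G t) (𝓝[>] (-T)) (𝓝 (E (-T) * G (-T))) :=
      ((hEc.mul hGc).tendsto (-T)).mono_left nhdsWithin_le_nhds
    have hz : E (-T) * G (-T) = 0 := by simp [hG]
    rw [hz] at hc
    obtain ⟨t₁, h1, h2⟩ := ((hc.eventually_lt_const hη).and
      (Ioc_mem_nhdsGT hts.1)).exists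
    refine ⟨t₁, h2.1, h2.2, fun x => ?_⟩
    have h3 : E t₁ * G t₁ * b x ≤ E t₁ * G t₁ :=
      mul_le_of_le_one_right (mul_nonneg (hE0 _).le (hGnn _ ⟨h2.1, h2.2.trans hts.2⟩)) (hb1 x)
    have : 0 ≤ α * (t₁ + T) := mul_nonneg hα0.le (by linarith [h2.1])
    simp only [hφ]
    linarith
  -- the minimum of the difference is attained
  have hsubI : Icc t₁ 0 ⊆ Ioc (-T) 0 := fun t ht => ⟨ht₁.trans_le ht.1, ht.2⟩
  have hsubB : Metric.closedBall (0 : Space d) (3 / 4 * R) ⊆ Metric.ball 0 R :=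
    Metric.closedBall_subset_ball (by linarith)
  have hlsc : LowerSemicontinuousOn (fun q : Space d × ℝ => u q.1 q.2 + -φ q.1 q.2)
      (Metric.closedBall (0 : Space d) (3 / 4 * R) ×ˢ Icc t₁ 0) := by
    refine (hu.lowerSemicontinuous.mono (prod_mono hsubB hsubI)).add ?_
    have : Continuous fun q : Space d × ℝ => -φ q.1 q.2 := by
      simp only [hφ]
      fun_prop
    exact this.lowerSemicontinuous.lowerSemicontinuousOn _
  have hmem : (xs, ts) ∈ Metric.closedBall (0 : Space d) (3 / 4 * R) ×ˢ Icc t₁ 0 :=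
    ⟨Metric.ball_subset_closedBall hxs, ht₁s, hts.2⟩
  obtain ⟨⟨x₀, t₀⟩, ⟨hx₀, ht₀⟩, hmin⟩ := LowerSemicontinuousOn.exists_isMinOn ⟨_, hmem⟩
    ((isCompact_closedBall _ _).prod isCompact_Icc) hlsc
  simp only at hx₀ ht₀
  set F₀ : ℝ := u x₀ t₀ - φ x₀ t₀ with hF₀
  have hF₀neg : F₀ < 0 := by
    have := hmin hmem
    simp only [mem_ofPred_eq] at this
    linarith
  have hle : ∀ x, ∀ t ∈ Icc t₁ 0, φ x t + F₀ ≤ u x t := fun x t ht => by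
    by_cases hx : x ∈ Metric.closedBall (0 : Space d) (3 / 4 * R)
    · have := hmin (mk_mem_prod hx ht)
      simp only [mem_ofPred_eq] at this
      linarith
    · have h1 : p x ≤ 0 := not_lt.1 fun h => hx (by
        simpa using ((paraboloid_pos_iff hR0 x).1 h).le)
      have h2 := hφz x h1 t (hsubI ht)
      have h3 := hu0 x t (hsubI ht)
      linarith
  have htI := hsubI ht₀
  have hu0' := hu0 x₀ t₀ htI
  have ht₁₀ : t₁ < t₀ := by
    refine lt_of_le_of_ne ht₀.1 fun h => ?_
    have := hφ1 x₀
    rw [h] at this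
    linarith
  set p₀ := p x₀ with hp₀
  have hp₀pos : 0 < p₀ := not_le.1 fun h => by
    have := hφz x₀ h t₀ htI
    linarith
  have hx₀' : ‖x₀‖ < 3 / 4 * R := (paraboloid_pos_iff hR0 x₀).1 hp₀pos
  have hp₀1 : p₀ ≤ 1 := hp1 x₀
  set M : ℝ := E t₀ * G t₀ with hM
  have hM0 : 0 ≤ M := mul_nonneg (hE0 _).le (hGnn _ htI)
  set Z : ℝ := F₀ - α * (t₀ + T) - η with hZ
  have hαt : 0 ≤ α * (t₀ + T) := mul_nonneg hα0.le (by linarith [htI.1])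
  have hux₀ : u x₀ t₀ = M * p₀ ^ 2 + Z := by
    have h1 := hbp x₀ hp₀pos.le
    have h2 : φ x₀ t₀ = M * p₀ ^ 2 - α * (t₀ + T) - η := by simp only [hφ, h1, hM, hp₀]
    rw [hZ]; linarith
  have hZneg : Z ≤ 0 := by linarith
  have hMp : M * p₀ ^ 2 ≤ M * p₀ := by
    refine mul_le_mul_of_nonneg_left ?_ hM0
    rw [sq]
    exact mul_le_of_le_one_left hp₀pos.le hp₀1
  -- the touching paraboloid
  set γ : ℝ := g t₀ + η / lam with hγ
  have hγpos : 0 < η / lam := by positivity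
  set ℓ : ℝ → ℝ := fun t => E t * (G t₀ - γ * (t₀ - t)) with hℓ
  have hEd : ∀ t, HasDerivAt E (-(κ / T) * E t) t := fun t => by
    have h := (((((hasDerivAt_id t).add_const T).div_const T).const_mul (-κ)).exp).const_mul (lam / 2)
    refine h.congr_deriv ?_
    simp only [hE, id]
    ring
  have hℓd : ∀ t, HasDerivAt ℓ (-(κ / T) * E t * (G t₀ - γ * (t₀ - t)) + E t * γ) t := fun t => by
    have h := (hEd t).mul ((((hasDerivAt_id t).const_sub t₀).const_mul γ).const_sub (G t₀))
    refine h.congr_deriv ?_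
    simp
  have hℓ0 : ℓ t₀ = M := by simp [hℓ, hM]
  set A : ℝ → ℝ := fun t => ℓ t * (p₀ * (2 - p₀)) - α * (t + T) - η + F₀ with hA
  set B : ℝ → ℝ := fun t => ℓ t * (2 * p₀ * (16 / 9 / R ^ 2)) with hB
  have hAB : ∀ x t, A t - B t * ‖x‖ ^ 2 = ℓ t * (p₀ * (2 * p x - p₀)) - α * (t + T) - η + F₀ := by
    intro x t
    simp only [hA, hB, hp, paraboloid]
    ring
  have hAd : Differentiable ℝ A := fun t => by
    have := (hℓd t).differentiableAt
    simp only [hA]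
    fun_prop
  have hBd : Differentiable ℝ B := fun t => by
    have := (hℓd t).differentiableAt
    simp only [hB]
    fun_prop
  have hABd : HasDerivAt (fun t => A t - B t * ‖x₀‖ ^ 2)
      ((-(κ / T) * M + lam / 2 * Real.exp (-κ * ((t₀ + T) / T)) * γ) * p₀ ^ 2
        - (R ^ (-(2 * s)) * a + η)) t₀ := by
    simp_rw [hAB]
    have h := ((((hℓd t₀).mul_const (p₀ * (2 * p x₀ - p₀))).sub
      (((hasDerivAt_id t₀).add_const T).const_mul α)).sub_const η).add_const F₀
    refine h.congr_deriv ?_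
    simp only [hM, sub_self, mul_zero, sub_zero, ← hp₀, hα, hE]
    ring
  obtain ⟨ε₀, hε₀, hε₀t, hε₀x, hε₀g⟩ : ∃ ε₀ > 0, ε₀ ≤ t₀ - t₁ ∧
      (∀ x ∈ Metric.ball x₀ ε₀, 0 < p₀ * (2 * p x - p₀)) ∧
      ∀ t ∈ Ioc (t₀ - ε₀) t₀, (g t : ℝ) ≤ γ := by
    have h1 : ∀ᶠ x in 𝓝 x₀, 0 < p₀ * (2 * p x - p₀) := by
      have hc : Continuous fun x => p₀ * (2 * p x - p₀) := by fun_prop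
      have hpos : 0 < p₀ * (2 * p₀ - p₀) := by
        rw [two_mul, add_sub_cancel_right]
        positivity
      exact hc.continuousAt.eventually (lt_mem_nhds hpos)
    have h2 : ∀ᶠ t in 𝓝 t₀, (g t : ℝ) ≤ γ := by
      have hlt : g t₀ < Real.toNNReal γ := by
        rw [Real.lt_toNNReal_iff_coe_lt]
        linarith
      filter_upwards [hgusc t₀ _ hlt] with t ht
      exact (Real.lt_toNNReal_iff_coe_lt.1 ht).le
    obtain ⟨δ₁, hδ₁, h1⟩ := Metric.eventually_nhds_iff_ball.1 h1
    obtain ⟨δ₂, hδ₂, h2⟩ := Metric.eventually_nhds_iff_ball.1 h2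
    refine ⟨min (t₀ - t₁) (min δ₁ δ₂), lt_min (by linarith) (lt_min hδ₁ hδ₂), min_le_left _ _,
      fun x hx => h1 x (Metric.ball_subset_ball ((min_le_right _ _).trans (min_le_left _ _)) hx),
      fun t ht => h2 t ?_⟩
    have h3 : min (t₀ - t₁) (min δ₁ δ₂) ≤ δ₂ := (min_le_right _ _).trans (min_le_right _ _)
    rw [Metric.mem_ball, Real.dist_eq, abs_lt]
    constructor <;> linarith [ht.1, ht.2]
  set P : ℝ := M * p₀ with hP
  have hP0 : 0 ≤ P := mul_nonneg hM0 hp₀pos.le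
  have hBt : B t₀ = 32 / 9 * P / R ^ 2 := by
    simp only [hB, hℓ0, hP]; ring
  have hfint : Integrable (fun x => u x t₀ * tailWeight d s R x) := by
    obtain ⟨N, hN⟩ := hu.bounded_measurable.bounded
    exact (Hk R hR0).1.bdd_mul (c := N)
      (hu.bounded_measurable.aemeasurable_slice t₀ htI).aestronglyMeasurable
      (Eventually.of_forall fun x => hN x t₀ htI)
  have hcontact := H ρ R _ u hρ hR hu0 hu x₀ t₀ ε₀ P _ A B (hsubB hx₀) htI hε₀ hAd hBd hABd
    (by rw [hAB, hℓ0, ← hp₀, hux₀, hZ]; ring)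
    (fun x hx t ht => by
      have htI' : t ∈ Icc t₁ 0 := ⟨by linarith [ht.1], ht.2.trans htI.2⟩
      refine le_trans ?_ (hle x t htI')
      rw [hAB]
      simp only [hφ]
      have h1 : ℓ t ≤ E t * G t := by
        refine mul_le_mul_of_nonneg_left ?_ (hE0 t).le
        exact primitive_le_tangent hgint ht.2 fun τ hτ =>
          hε₀g τ ⟨ht.1.trans_le hτ.1, hτ.2⟩
      have h2 := mul_le_mul_of_nonneg_right h1 (hε₀x x hx).le
      have h3 := mul_le_mul_of_nonneg_left (tangent_le_sq_posPart (p := p x) hp₀pos.le)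
        (mul_nonneg (hE0 t).le (hGnn t (hsubI htI')))
      linarith)
    (fun x => by
      refine le_trans ?_ (hle x t₀ ht₀)
      rw [hAB, hℓ0]
      simp only [hφ]
      have h3 := mul_le_mul_of_nonneg_left (tangent_le_sq_posPart (p := p x) hp₀pos.le) hM0
      linarith)
    hP0 (by rw [hBt]; positivity)
    (by rw [hBt]; gcongr; linarith)
    (by
      rw [hBt]
      calc 2 * (32 / 9 * P / R ^ 2) * ‖x₀‖ ≤ 2 * (32 / 9 * P / R ^ 2) * (3 / 4 * R) := by gcongr
        _ = 16 / 3 * P / R := by field_simp; ring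
        _ ≤ 6 * P / R := by gcongr; norm_num)
    (by rw [hux₀]; linarith)
    (by
      have h1 : A t₀ = M * (p₀ * (2 - p₀)) + Z := by simp only [hA, hℓ0, hZ]; ring
      have h2 : 0 ≤ M * p₀ ^ 2 := by positivity
      rw [h1]
      calc M * (p₀ * (2 - p₀)) + Z = 2 * P - M * p₀ ^ 2 + Z := by rw [hP]; ring
        _ ≤ 3 * P := by linarith only [h2, hZneg, hP0])
  -- Nonnegativity of `u x₀ t₀ = M p₀² + Z` gives `Z ≥ -M p₀²`. On `B_{R/2}` the profile is at least
  -- `1/4`, so `u(·, t₀) ≥ M/4 + Z ≥ M/4 - M p₀²` there.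
  have hfM := Hω R (M / 4 - M * p₀ ^ 2) (fun x => u x t₀) hR0 hfint (fun x => hu0 x t₀ htI)
    (fun x hx => by
      refine le_trans ?_ (hle x t₀ ht₀)
      have h1 : 1 / 2 ≤ p x := half_le_paraboloid hR0 (by simpa using hx)
      have h2 : M * (1 / 4) ≤ M * b x := by
        refine mul_le_mul_of_nonneg_left ?_ hM0
        rw [hbp x (one_half_pos.le.trans h1)]
        calc (1 / 4 : ℝ) = (1 / 2) ^ 2 := by norm_num
          _ ≤ p x ^ 2 := pow_le_pow_left₀ one_half_pos.le h1 2
      simp only [hφ]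
      linarith)
  refine barrier_contradiction (C := C') (I := Lam * (6 * P / R) + C * P * R ^ (-(2 * s)))
    (f := ∫ x, u x t₀ * tailWeight d s R x) (γ := γ) (a' := R ^ (-(2 * s)) * a)
    hσ0 hM0 hT0 hp₀pos.le hp₀1 hη hlam rfl (Real.exp_pos _).le ?_
    (integral_nonneg fun x => mul_nonneg (hu0 x t₀ htI) (tailWeight_pos hR0 x).le)
    (by rw [hγ]; linarith [hgf t₀ htI]) hκ rfl ?_ ?_ (hcontact.trans (by linarith))
  · rw [Real.exp_le_one_iff]
    have : 0 ≤ κ * ((t₀ + T) / T) :=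
      mul_nonneg (by positivity) (div_nonneg (by linarith [htI.1]) hT0.le)
    linarith
  · refine le_trans (le_of_eq ?_) hfM
    rw [hTinv, hσ]
    field_simp
  · have h1 : R ^ (2 * s - 1) ≤ R₀ ^ (2 * s - 1) := Real.rpow_le_rpow hR0.le hRR₀ (by linarith)
    have h2 : R⁻¹ = R ^ (2 * s - 1) * T⁻¹ := by
      rw [Real.rpow_sub hR0, Real.rpow_one, ← hT]
      field_simp
    calc Lam * (6 * P / R) + C * P * R ^ (-(2 * s))
        = 6 * Lam * P * R⁻¹ + C * P * T⁻¹ := by rw [hTinv]; ring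
      _ = 6 * Lam * P * (R ^ (2 * s - 1) * T⁻¹) + C * P * T⁻¹ := by rw [h2]
      _ ≤ 6 * Lam * P * (R₀ ^ (2 * s - 1) * T⁻¹) + C * P * T⁻¹ := by gcongr
      _ = C' * P / T := by rw [hC']; ring

/-! ### From the barrier to the weak Harnack inequality -/

/-- The weighted spatial integral of a bounded measurable function is integrable in time. -/
theorem IsBoundedMeasurable.integrableOn_integral_tailWeight {d : ℕ} {s R : ℝ} (hs : 0 < s)
    (hR : 0 < R) {u : Space d → ℝ → ℝ} (hu : IsBoundedMeasurable (timeInterval s R) u) :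
    IntegrableOn (fun t => ∫ x, u x t * tailWeight d s R x) (timeInterval s R) := by
  obtain ⟨Ck, -, Hk⟩ := exists_integral_tailWeight_eq d hs
  obtain ⟨N, hN⟩ := hu.bounded
  have hm := hu.aemeasurable
  rw [Measure.volume_eq_prod, ← Measure.prod_restrict, Measure.restrict_univ] at hm
  have hm2 : AEStronglyMeasurable (fun q : Space d × ℝ => u q.1 q.2 * tailWeight d s R q.1)
      (volume.prod (volume.restrict (timeInterval s R))) :=
    (hm.mul (((continuous_tailWeight hR).comp continuous_fst).aemeasurable)).aestronglyMeasurable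
  have hm3 := hm2.prod_swap.integral_prod_right'
  have hfin : volume (timeInterval s R) ≠ ⊤ := measure_Ioc_lt_top.ne
  refine Integrable.mono' (g := fun _ => N * ∫ x, tailWeight d s R x)
    (integrableOn_const hfin) hm3 ?_
  refine (ae_restrict_iff' measurableSet_Ioc).2 (Eventually.of_forall fun t ht => ?_)
  rw [← integral_const_mul]
  refine norm_integral_le_of_norm_le ((Hk R hR).1.const_mul N) (Eventually.of_forall fun x => ?_)
  rw [norm_mul, Real.norm_of_nonneg (tailWeight_pos hR x).le]
  exact mul_le_mul_of_nonneg_right (hN x t ht) (tailWeight_pos hR x).le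

/-- Upper semicontinuous approximation from below of a nonnegative function supported in an
interval, in terms of its primitive. -/
theorem exists_upperSemicontinuous_primitive_ge {f : ℝ → ℝ} {b b' : ℝ} (hb : b ≤ b')
    (hf : IntegrableOn f (Ioc b b')) (hf0 : ∀ t ∈ Ioc b b', 0 ≤ f t) {δ : ℝ} (hδ : 0 < δ) :
    ∃ g : ℝ → NNReal, UpperSemicontinuous g ∧ Integrable (fun t => (g t : ℝ)) ∧
      (∀ t ∈ Ioc b b', (g t : ℝ) ≤ f t) ∧ (∀ t ∉ Ioc b b', g t = 0) ∧
      ∀ t, b' ≤ t → (∫ τ in Ioc b b', f τ) - δ ≤ ∫ τ in b..t, (g τ : ℝ) := by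
  have hcoe : (fun t => (((Ioc b b').indicator f t).toNNReal : ℝ)) = (Ioc b b').indicator f := by
    funext t
    rw [Real.coe_toNNReal]
    exact indicator_nonneg hf0 t
  obtain ⟨g, hgf, hgu, hgi, hgI⟩ := exists_upperSemicontinuous_le_integral_le
    (fun t => ((Ioc b b').indicator f t).toNNReal)
    (by rw [hcoe]; exact hf.integrable_indicator measurableSet_Ioc) hδ
  rw [hcoe, integral_indicator measurableSet_Ioc] at hgI
  have hg0 : ∀ t ∉ Ioc b b', g t = 0 := fun t ht => by
    have := hgf t
    rw [indicator_of_notMem ht, Real.toNNReal_zero] at this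
    exact le_antisymm this zero_le
  refine ⟨g, hgu, hgi, fun t ht => ?_, hg0, fun t ht => ?_⟩
  · have := hgf t
    rwa [indicator_of_mem ht, ← NNReal.coe_le_coe, Real.coe_toNNReal _ (hf0 t ht)] at this
  · rw [intervalIntegral.integral_of_le (hb.trans ht),
      setIntegral_eq_integral_of_forall_compl_eq_zero (s := Ioc b t)]
    · exact hgI
    · intro τ hτ
      rw [hg0 τ fun h => hτ ⟨h.1, h.2.trans ht⟩, NNReal.coe_zero]

theorem weak_harnack_pointwise (d : ℕ) (hd : 1 ≤ d) {s lam Lam R₀ : ℝ} (hs : 1 / 2 ≤ s)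
    (hs1 : s < 1) (hlam : 0 < lam) (hLam : 0 < Lam) (hR₀ : 0 < R₀) :
    ∃ c : ℝ, 0 < c ∧ ∀ (ρ R a : ℝ) (u : Space d → ℝ → ℝ), 0 ≤ ρ → ρ < R → R ≤ R₀ → 0 ≤ a →
      (∀ x, ∀ t ∈ timeInterval s R, 0 ≤ u x t) →
      IsViscositySupersolution (driftPucciMin s lam Lam ρ) (Metric.ball (0 : Space d) R)
        (timeInterval s R) (fun _ _ => -(R ^ (-(2 * s)) * a)) u →
      ∀ x ∈ Metric.ball (0 : Space d) (R / 2), ∀ t ∈ timeInterval s (R / 2),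
        c * (∫ τ in timeInterval s R \ timeInterval s (R / 2), ∫ x, u x τ * tailWeight d s R x) - a
          ≤ u x t := by
  obtain ⟨κ, hκ, H⟩ := exists_barrier_le d hd hs hs1 hlam hLam hR₀
  -- On `Q_{R/2}` the time factor is at least `(lam/2) exp(-κ)`, because `(t + T)/T ≤ 1`, and the
  -- profile is at least `(1/2)²`.
  refine ⟨lam / 2 * Real.exp (-κ) / 4, by positivity, ?_⟩
  intro ρ R a u hρ hR hRR₀ ha hu0 hu x hx t ht
  have hR0 : 0 < R := hρ.trans_lt hR
  set T : ℝ := R ^ (2 * s) with hT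
  set T' : ℝ := (R / 2) ^ (2 * s) with hT'
  have hT0 : 0 < T := by positivity
  have hT'T : T' ≤ T := Real.rpow_le_rpow (by positivity) (by linarith) (by linarith)
  have hT'0 : 0 < T' := by positivity
  have hI : timeInterval s R = Ioc (-T) 0 := rfl
  have hI' : timeInterval s (R / 2) = Ioc (-T') 0 := rfl
  have hdiff : timeInterval s R \ timeInterval s (R / 2) = Ioc (-T) (-T') := by
    ext τ
    simp only [hI, hI', Set.mem_sdiff, mem_Ioc, not_and, not_le]
    constructor
    · rintro ⟨⟨h1, h2⟩, h3⟩
      exact ⟨h1, not_lt.1 fun h => (h3 h).not_ge h2⟩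
    · rintro ⟨h1, h2⟩
      exact ⟨⟨h1, by linarith⟩, fun h => absurd h h2.not_gt⟩
  rw [hI'] at ht
  rw [hdiff]
  have hsub : Ioc (-T) (-T') ⊆ timeInterval s R := Ioc_subset_Ioc_right (by linarith)
  have htI : t ∈ timeInterval s R := ⟨by linarith [ht.1], ht.2⟩
  have hfnn : ∀ τ ∈ timeInterval s R, 0 ≤ ∫ x, u x τ * tailWeight d s R x := fun τ hτ =>
    integral_nonneg fun x => mul_nonneg (hu0 x τ hτ) (tailWeight_pos hR0 x).le
  have hfi := (hu.bounded_measurable.integrableOn_integral_tailWeight (by linarith) hR0).mono_set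
    hsub
  set J : ℝ := ∫ τ in Ioc (-T) (-T'), ∫ x, u x τ * tailWeight d s R x with hJ
  set c : ℝ := lam / 2 * Real.exp (-κ) / 4 with hc
  have hc0 : 0 < c := by positivity
  have key : ∀ δ > 0, c * (J - δ) - a - δ * (1 + T) ≤ u x t := by
    intro δ hδ
    -- Since `g` vanishes after time `-T'`, it stays below the tail integral on all of `I_R`, and
    -- its primitive at any `t ≥ -T'` already contains its full mass.
    obtain ⟨g, hgu, hgi, hgf, hg0, hgJ⟩ := exists_upperSemicontinuous_primitive_ge
      (neg_le_neg hT'T) hfi (fun τ hτ => hfnn τ (hsub hτ)) hδ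
    have hb := H ρ R a u hρ hR hRR₀ ha hu0 hu g δ hgu hgi (fun τ hτ => by
      by_cases h : τ ∈ Ioc (-T) (-T')
      · exact hgf τ h
      · rw [hg0 τ h]; exact hfnn τ hτ) hδ x
      (Metric.ball_subset_ball (by linarith) hx) t htI
    refine le_trans ?_ hb
    have hp := half_le_paraboloid hR0 (x := x) (by simpa using hx)
    have hG := hgJ t ht.1.le
    have hGnn : 0 ≤ ∫ τ in (-T)..t, (g τ : ℝ) :=
      intervalIntegral.integral_nonneg htI.1.le fun _ _ => NNReal.coe_nonneg _
    have hE : Real.exp (-κ) ≤ Real.exp (-κ * ((t + T) / T)) := by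
      rw [Real.exp_le_exp]
      have h1 : (t + T) / T ≤ 1 := (div_le_one hT0).2 (by linarith [ht.2])
      have := mul_le_mul_of_nonneg_left h1 hκ.le
      linarith
    have h1 : c * (J - δ) ≤ lam / 2 * Real.exp (-κ * ((t + T) / T)) *
        (∫ τ in (-T)..t, (g τ : ℝ)) * paraboloid d R x ^ 2 := by
      calc c * (J - δ) ≤ c * ∫ τ in (-T)..t, (g τ : ℝ) := by gcongr
        _ = lam / 2 * Real.exp (-κ) * (∫ τ in (-T)..t, (g τ : ℝ)) * (1 / 2) ^ 2 := by
            rw [hc]; ring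
        _ ≤ _ := by gcongr
    have h2 : (R ^ (-(2 * s)) * a + δ) * (t + T) ≤ (R ^ (-(2 * s)) * a + δ) * T :=
      mul_le_mul_of_nonneg_left (by linarith [ht.2]) (by positivity)
    have h3 : R ^ (-(2 * s)) * T = 1 := by
      rw [hT, ← Real.rpow_add hR0, neg_add_cancel, Real.rpow_zero]
    have h4 : (R ^ (-(2 * s)) * a + δ) * T = a + δ * T := by linear_combination a * h3
    linarith
  refine le_of_forall_pos_sub_le fun ε hε => ?_
  have hpos : 0 < c + 1 + T := by positivity
  have := key (ε / (c + 1 + T)) (by positivity)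
  have h5 : ε / (c + 1 + T) * (c + 1 + T) = ε := div_mul_cancel₀ _ hpos.ne'
  linarith

end NonlocalHarnack

end

theorem mainTheorem2 (d : ℕ) (hd : 1 ≤ d) (s : ℝ) (hs : 1 / 2 ≤ s) (hs1 : s < 1)
    (lam Lam R₀ : ℝ) (hlam : 0 < lam) (hLam : 0 < Lam) (hR₀ : 0 < R₀) :
    ∃ c : ℝ, 0 < c ∧
      ∀ ρ : ℝ, 0 ≤ ρ → ∀ R : ℝ, ρ < R → R ≤ R₀ → ∀ a : ℝ, 0 ≤ a →
      ∀ u : NonlocalHarnack.Space d → ℝ → ℝ,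
        (∀ x, ∀ t ∈ NonlocalHarnack.timeInterval s R, 0 ≤ u x t) →
        NonlocalHarnack.IsViscositySupersolution
          (NonlocalHarnack.driftPucciMin s lam Lam ρ)
          (Metric.ball (0 : NonlocalHarnack.Space d) R)
          (NonlocalHarnack.timeInterval s R)
          (fun _ _ => -(R ^ (-(2 * s)) * a)) u →
        c * (∫ t in NonlocalHarnack.timeInterval s R \ NonlocalHarnack.timeInterval s (R / 2),
              ∫ x : NonlocalHarnack.Space d, u x t / (R + ‖x‖) ^ ((d : ℝ) + 2 * s)) - a
          ≤ ⨅ p : NonlocalHarnack.cylinder d s (R / 2), u p.1.1 p.1.2 := by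
  obtain ⟨c, hc, H⟩ := NonlocalHarnack.weak_harnack_pointwise d hd hs hs1 hlam hLam hR₀
  refine ⟨c, hc, fun ρ hρ R hR hRR₀ a ha u hu0 hu => ?_⟩
  have hR0 : 0 < R := hρ.trans_lt hR
  -- A real infimum over an empty index type would be `0`; the cylinder contains the origin.
  have : Nonempty (NonlocalHarnack.cylinder d s (R / 2)) :=
    ⟨⟨(0, 0), Metric.mem_ball_self (by positivity),
      neg_lt_zero.2 (Real.rpow_pos_of_pos (by positivity) _), le_rfl⟩⟩
  simp only [NonlocalHarnack.div_eq_mul_tailWeight hR0]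
  exact le_ciInf fun p => H ρ R a u hρ hR hRR₀ ha hu0 hu p.1.1 p.2.1 p.1.2 p.2.2
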